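/- Let $n\ge 0$ and let $G$ be a PL graph on $\mathbb{Z}^n$: a simple graph with vertex set $\mathbb{Z}^n$ for which there are distinct integer vectors $v_1,\dots,v_k\in\mathbb{Z}^n$, with $v_i\neq -v_j$ for all $i,j$, each with relatively prime entries, together spanning $\mathbb{R}^n$, such that the neighbours of each $u\in\mathbb{Z}^n$ are precisely the points $u\pm v_1,\dots,u\pm v_k$. Let $\ell_i=\{t v_i : 0\le t\le 1\}$ be the edge segments of $G$ and let $$Z=\sum_{i=1}^k(-\ell_i+\ell_i)\subset\mathbb{R}^n ,$$ where all sums are Minkowski sums. Let $\mu_n$ be Lebesgue (outer) measure on $\mathbb{R}^n$ and, for $A\subset\mathbb{R}^n$ with $\mu_n(A)<\infty$, put $$b(A)=\lim_{\varepsilon\to0^+}\frac{\mu_n(A+\varepsilon Z)-\mu_n(A)}{\varepsilon}\in[0,\infty]$$ whenever this limit exists. Let $X=cZ$ with $c>0$. Then $b(X)$ exists and is finite, and: 1. for every set $A\subset\mathbb{R}^n$ with $\mu_n(A)=\mu_n(X)$ for which $b(A)$ exists, $b(X)\le b(A)$; 2. for every convex body (nonempty compact convex set) $A\subset\mathbb{R}^n$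 with $\mu_n(A)=\mu_n(X)$, the limit $b(A)$ exists and is finite, $b(X)\le b(A)$, and $b(X)=b(A)$ if and only if $A$ is homothetic to $X$, that is, $A=x+rX$ for some $x\in\mathbb{R}^n$ and $r>0$. -/

import Mathlib

open Filter Topology MeasureTheory
open scoped Pointwise ENNReal NNReal

/-- The integer vector `a`, seen as a vector of `ℝⁿ`. -/
def intVec {n : ℕ} (a : Fin n → ℤ) : Fin n → ℝ := fun j => (a j : ℝ)

/-- `G` is a PL graph (primitive lattice graph) on `ℤⁿ` whose edges are given by the
vectors `v 0, …, v (k - 1)`. -/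
structure IsPLGraph {n k : ℕ} (G : SimpleGraph (Fin n → ℤ)) (v : Fin k → Fin n → ℤ) : Prop where
  /-- the vectors are pairwise distinct, so that `G` is regular of degree `2k` -/
  injective : Function.Injective v
  /-- no vector is the negative of a vector of the family (in particular none is zero) -/
  ne_neg : ∀ i j, v i ≠ -v j
  /-- the edges at `u` are precisely those to the points `u ± v i` -/
  adj_iff : ∀ u w, G.Adj u w ↔ ∃ i, w = u + v i ∨ w = u - v i
  /-- each vector is primitive: its entries are relatively prime -/
  primitive : ∀ i, Finset.univ.gcd (v i) = 1
  /-- the vectors span `ℝⁿ` -/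
  span_eq_top : Submodule.span ℝ (Set.range fun i => intVec (v i)) = ⊤

/-- The edge segment `ℓ i`, from the origin to `v i`. -/
def edgeSegment {n k : ℕ} (v : Fin k → Fin n → ℤ) (i : Fin k) : Set (Fin n → ℝ) :=
  segment ℝ 0 (intVec (v i))

/-- The zonotope `Z = ∑ i, (-ℓ i + ℓ i)`; all sums are Minkowski sums. -/
def zonotope {n k : ℕ} (v : Fin k → Fin n → ℤ) : Set (Fin n → ℝ) :=
  ∑ i, (-edgeSegment v i + edgeSegment v i)

/-- `b(A) = β`, where `b(A)` is the limit of `(μ(A + εZ) - μ(A)) / ε` as `ε → 0⁺`, with values in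
`[0, ∞]`; `μ` is Lebesgue measure (outer measure, should a set not be measurable). It is used
for `0 ∈ Z` and `μ(A) < ∞`, where `A ⊆ A + εZ` and the subtraction is a genuine one. -/
def HasBoundary {n : ℕ} (Z A : Set (Fin n → ℝ)) (β : ℝ≥0∞) : Prop :=
  Tendsto (fun ε : ℝ => (volume (A + ε • Z) - volume A) / ENNReal.ofReal ε) (𝓝[>] 0) (𝓝 β)

/-- `A` is homothetic to `B`: it is a translate of a positive multiple of `B`. -/
def Homothetic {n : ℕ} (A B : Set (Fin n → ℝ)) : Prop :=
  ∃ r : ℝ, 0 < r ∧ ∃ x : Fin n → ℝ, A = (fun y => x + r • y) '' B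

/-!
The set `Z` enters only as a compact convex set with nonempty interior: the zonotope contains `0`
and the vectors `v i`, which span. In dimension `0` all volumes of nonempty sets are `1` and every
boundary is `0`; let `n = m + 1` from here on.

**The inequality.** By Brunn–Minkowski, `|A + εZ|^(1/n) ≥ |A|^(1/n) + ε |Z|^(1/n)`, with equality
for `A = cZ`, so comparing derivatives at `ε = 0` gives `b(X) ≤ b(A)`. For an arbitrary set `A`
and outer measure, a small part of `εZ` is first spent on making `A` open
(`ofReal_add_mul_pow_le`). For convex `A` the function `ε ↦ |A + εZ|^(1/n)` is concave and has
bounded difference quotients, so the limit `b(A)` exists and is finite (`exists_hasBoundary`).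
Since concave functions lie below their tangents, `b(A) = b(X)` forces `|A + X| ≤ 2 ^ n |A|`:
equality in Brunn–Minkowski.

**Brunn–Minkowski** (`brunnMinkowski_pi`) is proved by induction on the dimension. If `p ^ m` and
`q ^ m` are the largest volumes of slices of `A` and `B` in `ℝ × ℝᵐ`, the layer cake formula for
the slice volumes and the one-dimensional inequality for their superlevel sets give `|A + B| ≥ (p
+ q) ^ m (|A| / p ^ m + |B| / q ^ m)` (`BrunnMinkowski.add_div_maxSlice_le`), and the convexity of
`x ↦ x ^ (m + 1)` does the rest.

**The equality case** (`exists_eq_translate_of_volume_add_le`). Let `A`, `B` be convex bodies with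
`|A| = |B|` and `|A + B| ≤ 2 ^ n |A|`. The sharpened inequality shows that their largest slices
have the same volume. When both bodies are cut by hyperplanes `φ = x` and `φ = y` that leave the
same volume on the left, the two left parts and the two right parts are again in the equality
case; as slice volumes are quasi-concave, the slice at `x` has the smaller of the largest slice
volumes of the two parts, and hence the same volume as the slice at `y`
(`sliceVol_eq_of_leftPart_eq`). So the quantile functions of `φ` on `A` and `B` have the same
derivative and differ by a constant, and the distance from the centroid to the supporting
hyperplane in direction `φ` is the same for `A` and `B`. As `φ` is arbitrary, `A` is the translate
of `B` by the difference of the centroids.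
-/

/-! ### The Brunn–Minkowski inequality -/

theorem IsCompact.volume_add_le_volume_add {K L : Set ℝ} (hK : IsCompact K) (hL : IsCompact L)
    (hK' : K.Nonempty) (hL' : L.Nonempty) : volume K + volume L ≤ volume (K + L) := by
  obtain ⟨a, ha, hamax⟩ := hK.exists_isGreatest hK'
  obtain ⟨b, hb, hbmin⟩ := hL.exists_isLeast hL'
  -- `K + min L` lies to the left of `max K + min L`, and `max K + L` to the right
  rw [← measure_inter_add_sdiff (K + L) (measurableSet_Iic (a := a + b))]
  refine add_le_add ?_ ?_
  · calc volume K = volume ((fun x => x + b) '' K) := by simp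
      _ ≤ _ := by
        refine measure_mono ?_
        rintro _ ⟨x, hx, rfl⟩
        exact ⟨Set.add_mem_add hx hb, by simpa using hamax hx⟩
  · calc volume L = volume ((fun x => a + x) '' L) := by simp
      _ = volume (((fun x => a + x) '' L) \ {a + b}) := by
        rw [measure_sdiff_null (by simp)]
      _ ≤ _ := by
        refine measure_mono ?_
        rintro _ ⟨⟨x, hx, rfl⟩, hne⟩
        refine ⟨Set.add_mem_add ha hx, fun h => hne ?_⟩
        have h1 : a + x ≤ a + b := h
        have h2 : b ≤ x := hbmin hx
        exact le_antisymm h1 (by simpa using h2)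

/-- The one-dimensional Brunn–Minkowski inequality, for measurable sets. -/
theorem MeasurableSet.volume_add_le_of_add_subset {S T U : Set ℝ} (hS : MeasurableSet S)
    (hT : MeasurableSet T) (hS' : S.Nonempty) (hT' : T.Nonempty) (hU : S + T ⊆ U) :
    volume S + volume T ≤ volume U := by
  -- adding a point makes the compact subsets nonempty
  have key : ∀ K ⊆ S, ∀ L ⊆ T, IsCompact K → IsCompact L → volume K + volume L ≤ volume U := by
    intro K hKS L hLT hK hL
    obtain ⟨s, hs⟩ := hS'
    obtain ⟨t, ht⟩ := hT'
    calc volume K + volume L ≤ volume (insert s K) + volume (insert t L) := by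
          gcongr <;> exact Set.subset_insert _ _
      _ ≤ volume (insert s K + insert t L) :=
          (hK.insert s).volume_add_le_volume_add (hL.insert t) (by simp) (by simp)
      _ ≤ volume U := measure_mono ((Set.add_subset_add (Set.insert_subset hs hKS)
          (Set.insert_subset ht hLT)).trans hU)
  rw [hS.measure_eq_iSup_isCompact, hT.measure_eq_iSup_isCompact]
  simp only [iSup_and']
  exact ENNReal.biSup_add_biSup_le' ⟨∅, by simp⟩ ⟨∅, by simp⟩
    fun K hK L hL => key K hK.1 L hL.1 hK.2 hL.2

/-- The layer cake formula, for a function bounded by `P` and with levels measured in units of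
`P`. -/
theorem lintegral_eq_mul_lintegral_level {f : ℝ → ℝ} (hf : Measurable f) (h0 : ∀ s, 0 ≤ f s)
    {P : ℝ} (hP : 0 < P) (hfP : ∀ s, f s ≤ P) :
    ∫⁻ s, ENNReal.ofReal (f s) =
      ENNReal.ofReal P * ∫⁻ r in Set.Ioo (0 : ℝ) 1, volume {s | r * P < f s} := by
  have h1 : ∀ s, ENNReal.ofReal (f s) = ENNReal.ofReal P * ENNReal.ofReal (f s / P) := by
    intro s
    rw [← ENNReal.ofReal_mul hP.le, mul_div_cancel₀ _ hP.ne']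
  simp_rw [h1]
  rw [lintegral_const_mul _ (by fun_prop)]
  congr 1
  rw [lintegral_eq_lintegral_meas_lt volume
    (Eventually.of_forall fun s => div_nonneg (h0 s) hP.le) (by fun_prop)]
  have h2 : ∀ r : ℝ, {s | r < f s / P} = {s | r * P < f s} := by
    intro r; ext s; exact lt_div_iff₀ hP
  simp_rw [h2]
  rw [← lintegral_indicator measurableSet_Ioi, ← lintegral_indicator measurableSet_Ioo]
  refine lintegral_congr fun r => ?_
  rcases le_or_gt 1 r with hr | hr
  · have hempty : {s | r * P < f s} = ∅ := by
      ext s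
      simp only [Set.mem_ofPred_eq, Set.mem_empty_iff_false, iff_false, not_lt]
      nlinarith [hfP s]
    simp [Set.indicator, hempty]
  · simp [Set.indicator, hr]

theorem mul_lintegral_level_le {h : ℝ → ℝ} (hh : Measurable h) (h0 : ∀ s, 0 ≤ h s)
    {R : ℝ} (hR : 0 < R) :
    ENNReal.ofReal R * ∫⁻ r in Set.Ioo (0 : ℝ) 1, volume {s | r * R ≤ h s} ≤
      ∫⁻ s, ENNReal.ofReal (h s) := by
  have h1 : ∀ s, ENNReal.ofReal (h s) = ENNReal.ofReal R * ENNReal.ofReal (h s / R) := by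
    intro s
    rw [← ENNReal.ofReal_mul hR.le, mul_div_cancel₀ _ hR.ne']
  simp_rw [h1]
  rw [lintegral_const_mul _ (by fun_prop)]
  refine mul_le_mul_right ?_ _
  rw [lintegral_eq_lintegral_meas_le volume
    (Eventually.of_forall fun s => div_nonneg (h0 s) hR.le) (by fun_prop)]
  have h2 : ∀ r : ℝ, {s | r ≤ h s / R} = {s | r * R ≤ h s} := by
    intro r; ext s; exact le_div_iff₀ hR
  simp_rw [h2]
  exact lintegral_mono_set Set.Ioo_subset_Ioi_self

/-- If the superlevel sets of `h`, scaled by `R`, contain the sums of those of `f` and `g`, scaled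
by their suprema `P` and `Q`, then the normalised integrals are superadditive. -/
theorem lintegral_div_add_lintegral_div_le {f g h : ℝ → ℝ} (hf : Measurable f) (hg : Measurable g)
    (hh : Measurable h) (hf0 : ∀ s, 0 ≤ f s) (hg0 : ∀ s, 0 ≤ g s) (hh0 : ∀ s, 0 ≤ h s)
    {P Q R : ℝ} (hP : IsLUB (Set.range f) P) (hQ : IsLUB (Set.range g) Q) (hP0 : 0 < P)
    (hQ0 : 0 < Q) (hR0 : 0 < R)
    (H : ∀ r, 0 < r → r < 1 → ∀ s t, r * P < f s → r * Q < g t → r * R ≤ h (s + t)) :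
    ENNReal.ofReal R * ((∫⁻ s, ENNReal.ofReal (f s)) / ENNReal.ofReal P +
      (∫⁻ s, ENNReal.ofReal (g s)) / ENNReal.ofReal Q) ≤ ∫⁻ s, ENNReal.ofReal (h s) := by
  rw [lintegral_eq_mul_lintegral_level hf hf0 hP0 fun s => hP.1 ⟨s, rfl⟩,
    lintegral_eq_mul_lintegral_level hg hg0 hQ0 fun s => hQ.1 ⟨s, rfl⟩,
    mul_comm (ENNReal.ofReal P), mul_comm (ENNReal.ofReal Q),
    ENNReal.mul_div_cancel_right (by simpa using hP0) ENNReal.ofReal_ne_top,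
    ENNReal.mul_div_cancel_right (by simpa using hQ0) ENNReal.ofReal_ne_top]
  refine le_trans ?_ (mul_lintegral_level_le hh hh0 hR0)
  gcongr
  have hmeas : Measurable fun r : ℝ => volume {s | r * P < f s} := by
    refine Antitone.measurable fun a b hab => measure_mono fun s hs => ?_
    exact lt_of_le_of_lt (mul_le_mul_of_nonneg_right hab hP0.le) hs
  rw [← lintegral_add_left hmeas]
  refine setLIntegral_mono' measurableSet_Ioo fun r hr => ?_
  refine MeasurableSet.volume_add_le_of_add_subset (measurableSet_lt measurable_const hf)
    (measurableSet_lt measurable_const hg) ?_ ?_ ?_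
  · obtain ⟨_, ⟨s, rfl⟩, hs⟩ := (lt_isLUB_iff hP).1 (show r * P < P by nlinarith [hr.2])
    exact ⟨s, hs⟩
  · obtain ⟨_, ⟨s, rfl⟩, hs⟩ := (lt_isLUB_iff hQ).1 (show r * Q < Q by nlinarith [hr.2])
    exact ⟨s, hs⟩
  · rintro _ ⟨s, hs, t, ht, rfl⟩
    exact H r hr.1 hr.2 s t hs ht

/-- The Brunn–Minkowski inequality in `n`-dimensional space, `|A + B|^(1/n) ≥ |A|^(1/n) + |B|^(1/n)`
for nonempty compact sets, stated without roots so that it makes sense for `n = 0`. -/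
def BrunnMinkowski (n : ℕ) (E : Type*) [AddCommGroup E] [TopologicalSpace E] [MeasureSpace E] :
    Prop :=
  ∀ ⦃A B : Set E⦄, IsCompact A → IsCompact B → A.Nonempty → B.Nonempty → ∀ ⦃a b : ℝ⦄, 0 ≤ a →
    0 ≤ b → a ^ n ≤ volume.real A → b ^ n ≤ volume.real B → (a + b) ^ n ≤ volume.real (A + B)

/-- The volume of the slice of `A` over `s`. -/
noncomputable def sliceVol {m : ℕ} (A : Set (ℝ × (Fin m → ℝ))) (s : ℝ) : ℝ :=
  volume.real (Prod.mk s ⁻¹' A)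

instance isAddHaarMeasure_volume_prod (m : ℕ) :
    (volume : Measure (ℝ × (Fin m → ℝ))).IsAddHaarMeasure := by
  rw [Measure.volume_eq_prod]
  infer_instance

section Slices

variable {m : ℕ} {A B : Set (ℝ × (Fin m → ℝ))}

theorem sliceVol_nonneg (A : Set (ℝ × (Fin m → ℝ))) (s : ℝ) : 0 ≤ sliceVol A s :=
  measureReal_nonneg

theorem IsCompact.slice (hA : IsCompact A) (s : ℝ) : IsCompact (Prod.mk s ⁻¹' A) := by
  refine (hA.image continuous_snd).of_isClosed_subset
    (hA.isClosed.preimage (Continuous.prodMk_right s)) ?_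
  exact fun y hy => ⟨_, hy, rfl⟩

theorem measurable_sliceVol (hA : IsCompact A) : Measurable (sliceVol A) :=
  (measurable_measure_prodMk_left hA.measurableSet).ennreal_toReal

theorem bddAbove_range_sliceVol (hA : IsCompact A) : BddAbove (Set.range (sliceVol A)) := by
  refine ⟨volume.real (Prod.snd '' A), ?_⟩
  rintro _ ⟨s, rfl⟩
  exact measureReal_mono (fun y hy => ⟨_, hy, rfl⟩) (hA.image continuous_snd).measure_lt_top.ne

theorem lintegral_sliceVol (hA : IsCompact A) :
    ∫⁻ s, ENNReal.ofReal (sliceVol A s) = volume A := by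
  rw [Measure.volume_eq_prod, Measure.prod_apply hA.measurableSet]
  refine lintegral_congr fun s => ?_
  exact ofReal_measureReal (hA.slice s).measure_lt_top.ne

theorem slice_add_slice_subset (A B : Set (ℝ × (Fin m → ℝ))) (s t : ℝ) :
    Prod.mk s ⁻¹' A + Prod.mk t ⁻¹' B ⊆ Prod.mk (s + t) ⁻¹' (A + B) := by
  rintro _ ⟨x, hx, y, hy, rfl⟩
  exact ⟨_, hx, _, hy, rfl⟩

theorem nonempty_of_sliceVol_pos {s : ℝ} (h : 0 < sliceVol A s) : (Prod.mk s ⁻¹' A).Nonempty := by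
  by_contra h'
  rw [Set.not_nonempty_iff_eq_empty] at h'
  simp [sliceVol, h'] at h

/-- The supremum of the slice volumes, a genuine one for compact `A`, whose slice volumes are
bounded. -/
noncomputable def maxSlice (A : Set (ℝ × (Fin m → ℝ))) : ℝ := ⨆ s, sliceVol A s

theorem isLUB_maxSlice (hA : IsCompact A) : IsLUB (Set.range (sliceVol A)) (maxSlice A) :=
  isLUB_ciSup (bddAbove_range_sliceVol hA)

theorem maxSlice_pos (hA : IsCompact A) (h : 0 < volume.real A) : 0 < maxSlice A := by
  by_contra! hle
  have h0 : ∀ s, sliceVol A s = 0 := fun s =>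
    le_antisymm (((isLUB_maxSlice hA).1 ⟨s, rfl⟩).trans hle) (sliceVol_nonneg A s)
  have := lintegral_sliceVol hA
  simp only [h0, ENNReal.ofReal_zero, lintegral_zero] at this
  simp [Measure.real, ← this] at h

end Slices

theorem volume_real_fin_zero {S : Set (Fin 0 → ℝ)} (hS : S.Nonempty) : volume.real S = 1 := by
  rw [Subsingleton.eq_univ_of_nonempty hS]
  simp [Measure.real, volume_pi]

/-- Also in dimension `m = 0`, where every nonempty slice has volume `1`. -/
theorem exists_pow_eq_maxSlice {m : ℕ} {A : Set (ℝ × (Fin m → ℝ))} (hA : IsCompact A)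
    (h : 0 < volume.real A) : ∃ p : ℝ, 0 < p ∧ p ^ m = maxSlice A := by
  have hpos := maxSlice_pos hA h
  rcases Nat.eq_zero_or_pos m with rfl | hm
  · refine ⟨1, one_pos, ?_⟩
    have hlub := isLUB_maxSlice hA
    obtain ⟨_, ⟨s, rfl⟩, hs⟩ := (lt_isLUB_iff hlub).1 hpos
    have h1 : sliceVol A s = 1 := volume_real_fin_zero (nonempty_of_sliceVol_pos hs)
    refine le_antisymm (by simpa [h1] using hlub.1 ⟨s, rfl⟩) (hlub.2 ?_)
    rintro _ ⟨t, rfl⟩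
    rcases (sliceVol_nonneg A t).eq_or_lt with h0 | h0
    · simp [← h0]
    · exact (volume_real_fin_zero (nonempty_of_sliceVol_pos h0)).le.trans (by simp)
  · exact ⟨maxSlice A ^ ((m : ℝ)⁻¹), by positivity,
      Real.rpow_inv_natCast_pow hpos.le hm.ne'⟩

/-- The Brunn–Minkowski inequality for sets of volume more than `(ρ p) ^ m` and `(ρ q) ^ m`, where
`r = ρ ^ m`; for `m = 0` there is no such `ρ`, and the volumes are `1`. -/
theorem BrunnMinkowski.level {m : ℕ} (hm : BrunnMinkowski m (Fin m → ℝ)) {K L : Set (Fin m → ℝ)}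
    (hK : IsCompact K) (hL : IsCompact L) {p q r : ℝ} (hp : 0 ≤ p) (hq : 0 ≤ q) (hr : 0 ≤ r)
    (hKr : r * p ^ m < volume.real K) (hLr : r * q ^ m < volume.real L) :
    r * (p + q) ^ m ≤ volume.real (K + L) := by
  have hK' : K.Nonempty := by
    rw [Set.nonempty_iff_ne_empty]; rintro rfl
    simp only [measureReal_empty] at hKr
    exact absurd hKr (by push Not; positivity)
  have hL' : L.Nonempty := by
    rw [Set.nonempty_iff_ne_empty]; rintro rfl
    simp only [measureReal_empty] at hLr
    exact absurd hLr (by push Not; positivity)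
  rcases Nat.eq_zero_or_pos m with rfl | hm0
  · rw [volume_real_fin_zero (hK'.add hL')]
    rw [volume_real_fin_zero hK'] at hKr
    simp at hKr ⊢
    exact hKr.le
  · have hρ : (r ^ ((m : ℝ)⁻¹)) ^ m = r := Real.rpow_inv_natCast_pow hr hm0.ne'
    have hρ0 : 0 ≤ r ^ ((m : ℝ)⁻¹) := by positivity
    set ρ := r ^ ((m : ℝ)⁻¹)
    have := hm hK hL hK' hL' (mul_nonneg hρ0 hp) (mul_nonneg hρ0 hq)
      (by rw [mul_pow, hρ]; exact hKr.le) (by rw [mul_pow, hρ]; exact hLr.le)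
    rwa [← mul_add, mul_pow, hρ] at this

/-- The sharpening of the Brunn–Minkowski inequality that takes the largest slices into account. -/
theorem BrunnMinkowski.add_div_maxSlice_le {m : ℕ} (hm : BrunnMinkowski m (Fin m → ℝ))
    {A B : Set (ℝ × (Fin m → ℝ))} (hA : IsCompact A) (hB : IsCompact B)
    {p q : ℝ} (hp : 0 < p) (hq : 0 < q) (hpA : p ^ m = maxSlice A) (hqB : q ^ m = maxSlice B) :
    (p + q) ^ m * (volume.real A / p ^ m + volume.real B / q ^ m) ≤ volume.real (A + B) := by
  have hAB := hA.add hB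
  have key := lintegral_div_add_lintegral_div_le (measurable_sliceVol hA) (measurable_sliceVol hB)
    (measurable_sliceVol hAB) (sliceVol_nonneg A) (sliceVol_nonneg B) (sliceVol_nonneg _)
    (P := p ^ m) (Q := q ^ m) (R := (p + q) ^ m) (hpA ▸ isLUB_maxSlice hA)
    (hqB ▸ isLUB_maxSlice hB) (by positivity) (by positivity) (by positivity) (by
      intro r hr0 hr1 s t hs ht
      refine (hm.level (hA.slice s) (hB.slice t) hp.le hq.le hr0.le hs ht).trans ?_
      exact measureReal_mono (slice_add_slice_subset A B s t) (hAB.slice _).measure_lt_top.ne)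
  rw [lintegral_sliceVol hA, lintegral_sliceVol hB, lintegral_sliceVol hAB,
    ← ofReal_measureReal hA.measure_lt_top.ne, ← ofReal_measureReal hB.measure_lt_top.ne,
    ← ofReal_measureReal hAB.measure_lt_top.ne, ← ENNReal.ofReal_div_of_pos (by positivity),
    ← ENNReal.ofReal_div_of_pos (by positivity), ← ENNReal.ofReal_add (by positivity)
    (by positivity), ← ENNReal.ofReal_mul (by positivity)] at key
  exact (ENNReal.ofReal_le_ofReal_iff measureReal_nonneg).1 key

theorem add_pow_succ_le {a b p q : ℝ} (ha : 0 ≤ a) (hb : 0 ≤ b) (hp : 0 < p) (hq : 0 < q) (m : ℕ) :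
    (a + b) ^ (m + 1) ≤ (p + q) ^ m * (a ^ (m + 1) / p ^ m + b ^ (m + 1) / q ^ m) := by
  have h := (convexOn_pow (𝕜 := ℝ) (m + 1)).2 (Set.mem_Ici.2 (show 0 ≤ a / p by positivity))
    (Set.mem_Ici.2 (show 0 ≤ b / q by positivity)) (show 0 ≤ p / (p + q) by positivity)
    (show 0 ≤ q / (p + q) by positivity) (by field_simp)
  simp only [smul_eq_mul] at h
  have e1 : p / (p + q) * (a / p) + q / (p + q) * (b / q) = (a + b) / (p + q) := by
    field_simp
  rw [e1, div_pow, div_le_iff₀ (by positivity)] at h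
  refine h.trans (le_of_eq ?_)
  rw [div_pow, div_pow, pow_succ (p + q), pow_succ p, pow_succ q]
  field_simp

theorem le_volume_real_add_left {E : Type*} [AddCommGroup E] [TopologicalSpace E] [ContinuousAdd E]
    [MeasureSpace E] [MeasurableAdd E] [(volume : Measure E).IsAddLeftInvariant]
    [IsFiniteMeasureOnCompacts (volume : Measure E)] {A B : Set E}
    (hA : IsCompact A) (hB : IsCompact B) (h : A.Nonempty) :
    volume.real B ≤ volume.real (A + B) := by
  obtain ⟨x, hx⟩ := h
  calc volume.real B = volume.real ((fun y => x + y) '' B) := by simp [Measure.real]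
    _ ≤ _ := measureReal_mono (by rintro _ ⟨y, hy, rfl⟩; exact Set.add_mem_add hx hy)
      (hA.add hB).measure_lt_top.ne

theorem BrunnMinkowski.prod {m : ℕ} (hm : BrunnMinkowski m (Fin m → ℝ)) :
    BrunnMinkowski (m + 1) (ℝ × (Fin m → ℝ)) := by
  intro A B hA hB hA' hB' a b ha hb haA hbB
  rcases ha.eq_or_lt with rfl | ha
  · simpa using hbB.trans (le_volume_real_add_left hA hB hA')
  rcases hb.eq_or_lt with rfl | hb
  · rw [add_comm A, add_zero]
    exact haA.trans (le_volume_real_add_left hB hA hB')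
  obtain ⟨p, hp, hpA⟩ := exists_pow_eq_maxSlice hA (lt_of_lt_of_le (by positivity) haA)
  obtain ⟨q, hq, hqB⟩ := exists_pow_eq_maxSlice hB (lt_of_lt_of_le (by positivity) hbB)
  refine le_trans ?_ (hm.add_div_maxSlice_le hA hB hp hq hpA hqB)
  refine (add_pow_succ_le ha.le hb.le hp hq m).trans ?_
  gcongr

theorem brunnMinkowski_pi (n : ℕ) : BrunnMinkowski n (Fin n → ℝ) := by
  induction n with
  | zero =>
    intro A B _ _ hA' hB' a b _ _ _ _
    simp [volume_real_fin_zero (hA'.add hB')]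
  | succ m ih =>
    intro A B hA hB hA' hB' a b ha hb haA hbB
    let e := MeasurableEquiv.piFinSuccAbove (fun _ : Fin (m + 1) => ℝ) 0
    have he : MeasurePreserving e := volume_preserving_piFinSuccAbove (fun _ => ℝ) 0
    have hc : Continuous e := by
      change Continuous fun x : Fin (m + 1) → ℝ =>
        (x 0, fun j : Fin m => x ((0 : Fin (m + 1)).succAbove j))
      fun_prop
    have hadd : ∀ x y, e (x + y) = e x + e y := fun x y => rfl
    have hv : ∀ S : Set (Fin (m + 1) → ℝ), volume.real (e '' S) = volume.real S := by
      intro S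
      rw [← e.preimage_symm, Measure.real, Measure.real,
        (MeasurePreserving.symm e he).measure_preimage_equiv]
    have hsum : e '' (A + B) = e '' A + e '' B :=
      Set.image_image2_distrib hadd
    have := ih.prod (hA.image hc) (hB.image hc) (hA'.image _) (hB'.image _) ha hb
      (by rwa [hv]) (by rwa [hv])
    rwa [← hsum, hv] at this

/-! ### Slices of convex bodies -/

theorem volume_real_smul_pi {n : ℕ} {t : ℝ} (ht : 0 ≤ t) (K : Set (Fin n → ℝ)) :
    volume.real (t • K) = t ^ n * volume.real K := by
  rw [Measure.real, Measure.addHaar_smul, Module.finrank_fin_fun, abs_of_nonneg (by positivity),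
    ENNReal.toReal_mul, ENNReal.toReal_ofReal (by positivity), Measure.real]

section ConvexSlices

variable {m : ℕ} {A B : Set (ℝ × (Fin m → ℝ))}

theorem combo_slice_subset (hA : Convex ℝ A) {s t a b : ℝ} (ha : 0 ≤ a) (hb : 0 ≤ b)
    (hab : a + b = 1) :
    a • (Prod.mk s ⁻¹' A) + b • (Prod.mk t ⁻¹' A) ⊆ Prod.mk (a * s + b * t) ⁻¹' A := by
  rintro _ ⟨_, ⟨x, hx, rfl⟩, _, ⟨y, hy, rfl⟩, rfl⟩
  exact hA hx hy ha hb hab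

/-- Brunn's theorem, without roots. -/
theorem combo_pow_le_sliceVol (hA : IsCompact A) (hc : Convex ℝ A) {s t a b p q : ℝ} (ha : 0 ≤ a)
    (hb : 0 ≤ b) (hab : a + b = 1) (hs : (Prod.mk s ⁻¹' A).Nonempty)
    (ht : (Prod.mk t ⁻¹' A).Nonempty) (hp : 0 ≤ p) (hq : 0 ≤ q) (hps : p ^ m ≤ sliceVol A s)
    (hqt : q ^ m ≤ sliceVol A t) : (a * p + b * q) ^ m ≤ sliceVol A (a * s + b * t) := by
  refine (brunnMinkowski_pi m ((hA.slice s).smul a) ((hA.slice t).smul b) (hs.smul_set)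
    (ht.smul_set) (mul_nonneg ha hp) (mul_nonneg hb hq) ?_ ?_).trans
    (measureReal_mono (combo_slice_subset hc ha hb hab) (hA.slice _).measure_lt_top.ne)
  · rw [volume_real_smul_pi ha, mul_pow]; gcongr; exact hps
  · rw [volume_real_smul_pi hb, mul_pow]; gcongr; exact hqt

/-- For `m = 0` the root is `1`, by the conventions `0⁻¹ = 0` and `x ^ 0 = 1`, and so is the volume
of a nonempty slice. -/
theorem rpow_sliceVol_pow {s : ℝ} (h : (Prod.mk s ⁻¹' A).Nonempty) :
    (sliceVol A s ^ ((m : ℝ)⁻¹)) ^ m = sliceVol A s := by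
  rcases Nat.eq_zero_or_pos m with rfl | hm
  · simpa [sliceVol] using (volume_real_fin_zero h).symm
  · exact Real.rpow_inv_natCast_pow (sliceVol_nonneg A s) hm.ne'

theorem exists_combo {x y z : ℝ} (h1 : x ≤ y) (h2 : y ≤ z) :
    ∃ a b : ℝ, 0 ≤ a ∧ 0 ≤ b ∧ a + b = 1 ∧ y = a * x + b * z := by
  have hy : y ∈ segment ℝ x z := by rw [segment_eq_Icc (h1.trans h2)]; exact ⟨h1, h2⟩
  obtain ⟨a, b, ha, hb, hab, h⟩ := hy
  exact ⟨a, b, ha, hb, hab, h.symm⟩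

/-- Slice volumes of a convex body are quasi-concave. -/
theorem min_sliceVol_le (hA : IsCompact A) (hc : Convex ℝ A) {x y z : ℝ} (h1 : x ≤ y)
    (h2 : y ≤ z) : min (sliceVol A x) (sliceVol A z) ≤ sliceVol A y := by
  by_contra! hlt
  obtain ⟨hx, hz⟩ := lt_min_iff.1 hlt
  have hx' := nonempty_of_sliceVol_pos ((sliceVol_nonneg A y).trans_lt hx)
  have hz' := nonempty_of_sliceVol_pos ((sliceVol_nonneg A y).trans_lt hz)
  obtain ⟨a, b, ha, hb, hab, rfl⟩ := exists_combo h1 h2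
  set p := sliceVol A x ^ ((m : ℝ)⁻¹) with hp
  set q := sliceVol A z ^ ((m : ℝ)⁻¹) with hq
  have hp0 : 0 ≤ p := Real.rpow_nonneg (sliceVol_nonneg _ _) _
  have hq0 : 0 ≤ q := Real.rpow_nonneg (sliceVol_nonneg _ _) _
  have e1 : p ^ m = sliceVol A x := rpow_sliceVol_pow hx'
  have e2 : q ^ m = sliceVol A z := rpow_sliceVol_pow hz'
  have h0 : 0 ≤ min p q := le_min hp0 hq0
  have := combo_pow_le_sliceVol hA hc ha hb hab hx' hz' h0 h0
    (e1 ▸ pow_le_pow_left₀ h0 (min_le_left _ _) m) (e2 ▸ pow_le_pow_left₀ h0 (min_le_right _ _) m)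
  rw [← add_mul, hab, one_mul] at this
  rcases min_choice p q with h | h <;> rw [h] at this <;> linarith

theorem slice_nonempty_of_mem_Icc (hc : Convex ℝ A) {α β s : ℝ} (hα : IsLeast (Prod.fst '' A) α)
    (hβ : IsGreatest (Prod.fst '' A) β) (hs : s ∈ Set.Icc α β) : (Prod.mk s ⁻¹' A).Nonempty := by
  have h : s ∈ Prod.fst '' A :=
    (hc.linear_image (LinearMap.fst ℝ ℝ (Fin m → ℝ))).ordConnected.out hα.1 hβ.1 hs
  obtain ⟨⟨_, y⟩, hy, rfl⟩ := h
  exact ⟨y, hy⟩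

theorem fst_mem_of_sliceVol_pos {s : ℝ} (h : 0 < sliceVol A s) : s ∈ Prod.fst '' A := by
  obtain ⟨y, hy⟩ := nonempty_of_sliceVol_pos h
  exact ⟨_, hy, rfl⟩

theorem sliceVol_pos_of_mem_Ioo (hA : IsCompact A) (hc : Convex ℝ A) (hV : 0 < volume.real A)
    {α β s : ℝ} (hα : IsLeast (Prod.fst '' A) α) (hβ : IsGreatest (Prod.fst '' A) β)
    (hs : s ∈ Set.Ioo α β) : 0 < sliceVol A s := by
  obtain ⟨_, ⟨x, rfl⟩, hx⟩ := (lt_isLUB_iff (isLUB_maxSlice hA)).1 (maxSlice_pos hA hV)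
  have hx' := fst_mem_of_sliceVol_pos hx
  have hαβ : α ≤ β := (hs.1.trans hs.2).le
  have hne := nonempty_of_sliceVol_pos hx
  have hp0 : 0 < sliceVol A x ^ ((m : ℝ)⁻¹) := Real.rpow_pos_of_pos hx _
  have hpx := rpow_sliceVol_pow hne
  have hnα := slice_nonempty_of_mem_Icc hc hα hβ (Set.left_mem_Icc.2 hαβ)
  have hnβ := slice_nonempty_of_mem_Icc hc hα hβ (Set.right_mem_Icc.2 hαβ)
  -- interpolate between `x` and the endpoint of the projection on the other side of `s`
  rcases Nat.eq_zero_or_pos m with rfl | hm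
  · have := volume_real_fin_zero (slice_nonempty_of_mem_Icc hc hα hβ (Set.Ioo_subset_Icc_self hs))
    rw [sliceVol, this]
    exact one_pos
  have hz : ∀ t, (0 : ℝ) ^ m ≤ sliceVol A t := fun t => by
    rw [zero_pow hm.ne']; exact sliceVol_nonneg A t
  rcases le_total x s with hxs | hsx
  · obtain ⟨a, b, ha, hb, hab, rfl⟩ := exists_combo hxs hs.2.le
    have ha' : 0 < a := by
      refine ha.lt_of_ne' fun h => ?_
      have : b = 1 := by linarith
      subst h this
      simpa using hs.2
    refine lt_of_lt_of_le ?_ (combo_pow_le_sliceVol hA hc ha hb hab hne hnβ hp0.le le_rfl hpx.le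
      (hz _))
    positivity
  · obtain ⟨a, b, ha, hb, hab, rfl⟩ := exists_combo hs.1.le hsx
    have hb' : 0 < b := by
      refine hb.lt_of_ne' fun h => ?_
      have : a = 1 := by linarith
      subst h this
      simpa using hs.1
    refine lt_of_lt_of_le ?_ (combo_pow_le_sliceVol hA hc ha hb hab hnα hne le_rfl hp0.le (hz _)
      hpx.le)
    positivity

theorem continuousOn_sliceVol (hA : IsCompact A) (hc : Convex ℝ A) {α β : ℝ}
    (hα : IsLeast (Prod.fst '' A) α) (hβ : IsGreatest (Prod.fst '' A) β) :
    ContinuousOn (sliceVol A) (Set.Ioo α β) := by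
  have hne : ∀ s ∈ Set.Ioo α β, (Prod.mk s ⁻¹' A).Nonempty := fun s hs =>
    slice_nonempty_of_mem_Icc hc hα hβ (Set.Ioo_subset_Icc_self hs)
  have hconc : ConcaveOn ℝ (Set.Ioo α β) fun s => sliceVol A s ^ ((m : ℝ)⁻¹) := by
    refine ⟨convex_Ioo α β, fun x hx y hy a b ha hb hab => ?_⟩
    rcases Nat.eq_zero_or_pos m with rfl | hm
    · simp [hab]
    have hz : a • x + b • y ∈ Set.Ioo α β := convex_Ioo α β hx hy ha hb hab
    have h0 : ∀ s, 0 ≤ sliceVol A s ^ ((m : ℝ)⁻¹) := fun s =>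
      Real.rpow_nonneg (sliceVol_nonneg _ _) _
    have := combo_pow_le_sliceVol hA hc ha hb hab (hne x hx) (hne y hy) (h0 x) (h0 y)
      (rpow_sliceVol_pow (hne x hx)).le (rpow_sliceVol_pow (hne y hy)).le
    rw [← smul_eq_mul a x, ← smul_eq_mul b y, ← rpow_sliceVol_pow (hne _ hz)] at this
    exact le_of_pow_le_pow_left₀ hm.ne' (h0 _) this
  refine ((hconc.continuousOn isOpen_Ioo).pow m).congr fun s hs => ?_
  exact (rpow_sliceVol_pow (hne s hs)).symm

/-! ### Cutting by a hyperplane -/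

/-- The part of `A` to the left of the hyperplane over `x`. -/
def leftPart (A : Set (ℝ × (Fin m → ℝ))) (x : ℝ) : Set (ℝ × (Fin m → ℝ)) := A ∩ {p | p.1 ≤ x}

/-- The part of `A` to the right of the hyperplane over `x`. -/
def rightPart (A : Set (ℝ × (Fin m → ℝ))) (x : ℝ) : Set (ℝ × (Fin m → ℝ)) := A ∩ {p | x ≤ p.1}

theorem IsCompact.leftPart (hA : IsCompact A) (x : ℝ) : IsCompact (leftPart A x) :=
  hA.inter_right (isClosed_le continuous_fst continuous_const)

theorem IsCompact.rightPart (hA : IsCompact A) (x : ℝ) : IsCompact (rightPart A x) :=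
  hA.inter_right (isClosed_le continuous_const continuous_fst)

theorem sliceVol_leftPart (A : Set (ℝ × (Fin m → ℝ))) (x : ℝ) :
    sliceVol (leftPart A x) = (Set.Iic x).indicator (sliceVol A) := by
  ext s
  by_cases h : s ≤ x <;> simp [sliceVol, leftPart, h]

theorem sliceVol_rightPart (A : Set (ℝ × (Fin m → ℝ))) (x : ℝ) :
    sliceVol (rightPart A x) = (Set.Ici x).indicator (sliceVol A) := by
  ext s
  by_cases h : x ≤ s <;> simp [sliceVol, rightPart, h]

theorem volume_real_leftPart_add_rightPart (hA : IsCompact A) (x : ℝ) :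
    volume.real (leftPart A x) + volume.real (rightPart A x) = volume.real A := by
  have h0 : volume ({p | p.1 = x} : Set (ℝ × (Fin m → ℝ))) = 0 := by
    have : ({p | p.1 = x} : Set (ℝ × (Fin m → ℝ))) = {x} ×ˢ Set.univ := by ext; simp
    rw [this, Measure.volume_eq_prod, Measure.prod_prod]; simp
  rw [leftPart, ← measureReal_inter_add_sdiff (s := A) (t := {p | p.1 ≤ x})
    (measurableSet_le measurable_fst measurable_const) hA.measure_lt_top.ne]
  congr 1
  refine measureReal_congr ?_
  have : ∀ᵐ p : ℝ × (Fin m → ℝ), p.1 ≠ x := by rw [ae_iff]; simpa using h0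
  filter_upwards [this] with p hp
  refine propext (and_congr_right fun _ => ?_)
  change x ≤ p.1 ↔ ¬ p.1 ≤ x
  rw [not_le]
  exact ⟨fun h => lt_of_le_of_ne h hp.symm, le_of_lt⟩

/-- By quasi-concavity, one of the two parts has its largest slice on the cutting hyperplane. -/
theorem sliceVol_eq_min (hA : IsCompact A) (hc : Convex ℝ A) (x : ℝ) :
    sliceVol A x = min (maxSlice (leftPart A x)) (maxSlice (rightPart A x)) := by
  have hL := isLUB_maxSlice (hA.leftPart x)
  have hR := isLUB_maxSlice (hA.rightPart x)
  refine le_antisymm (le_min (hL.1 ⟨x, by simp [sliceVol_leftPart]⟩)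
    (hR.1 ⟨x, by simp [sliceVol_rightPart]⟩)) ?_
  by_contra! hlt
  obtain ⟨h1, h2⟩ := lt_min_iff.1 hlt
  obtain ⟨_, ⟨s, rfl⟩, hs⟩ := (lt_isLUB_iff hL).1 h1
  obtain ⟨_, ⟨t, rfl⟩, ht⟩ := (lt_isLUB_iff hR).1 h2
  have hx := sliceVol_nonneg A x
  rw [sliceVol_leftPart] at hs
  rw [sliceVol_rightPart] at ht
  have hsx : s ∈ Set.Iic x := by
    by_contra h
    rw [Set.indicator_of_notMem h] at hs
    exact hs.not_ge hx
  have htx : t ∈ Set.Ici x := by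
    by_contra h
    rw [Set.indicator_of_notMem h] at ht
    exact ht.not_ge hx
  rw [Set.indicator_of_mem hsx] at hs
  rw [Set.indicator_of_mem htx] at ht
  exact (lt_min hs ht).not_ge (min_sliceVol_le hA hc hsx htx)

theorem integrable_fst_indicator (hA : IsCompact A) :
    Integrable (A.indicator (Prod.fst : ℝ × (Fin m → ℝ) → ℝ)) (volume.prod volume) := by
  rw [← Measure.volume_eq_prod, integrable_indicator_iff hA.measurableSet]
  exact continuous_fst.continuousOn.integrableOn_compact hA

theorem integral_fst_indicator_slice (hA : IsCompact A) (s : ℝ) :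
    ∫ y, A.indicator Prod.fst (s, y) = s * sliceVol A s := by
  have : ∀ y, A.indicator (Prod.fst : ℝ × (Fin m → ℝ) → ℝ) (s, y) =
      (Prod.mk s ⁻¹' A).indicator (fun _ => s) y := fun y => rfl
  simp_rw [this]
  rw [integral_indicator_const _ (hA.slice s).measurableSet, smul_eq_mul, mul_comm, sliceVol]

theorem integrable_mul_sliceVol (hA : IsCompact A) : Integrable fun s => s * sliceVol A s := by
  simpa only [integral_fst_indicator_slice hA] using
    (integrable_fst_indicator hA).integral_prod_left

theorem setIntegral_fst (hA : IsCompact A) : ∫ p in A, p.1 = ∫ s, s * sliceVol A s := by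
  rw [← integral_indicator hA.measurableSet, Measure.volume_eq_prod,
    integral_prod _ (integrable_fst_indicator hA)]
  simp only [integral_fst_indicator_slice hA]

theorem integrable_sliceVol (hA : IsCompact A) : Integrable (sliceVol A) := by
  refine ⟨(measurable_sliceVol hA).aestronglyMeasurable, ?_⟩
  rw [hasFiniteIntegral_iff_ofReal (Eventually.of_forall (sliceVol_nonneg A)),
    lintegral_sliceVol hA]
  exact hA.measure_lt_top

theorem integral_sliceVol (hA : IsCompact A) : ∫ s, sliceVol A s = volume.real A := by
  rw [integral_eq_lintegral_of_nonneg_ae (Eventually.of_forall (sliceVol_nonneg A))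
    (measurable_sliceVol hA).aestronglyMeasurable, lintegral_sliceVol hA, Measure.real]

theorem volume_real_leftPart (hA : IsCompact A) (x : ℝ) :
    volume.real (leftPart A x) = ∫ s in Set.Iic x, sliceVol A s := by
  rw [← integral_sliceVol (hA.leftPart x), sliceVol_leftPart, integral_indicator measurableSet_Iic]

theorem volume_real_leftPart_sub (hA : IsCompact A) (x y : ℝ) :
    volume.real (leftPart A y) - volume.real (leftPart A x) = ∫ s in x..y, sliceVol A s := by
  rw [volume_real_leftPart hA, volume_real_leftPart hA]
  exact intervalIntegral.integral_Iic_sub_Iic (integrable_sliceVol hA).integrableOn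
    (integrable_sliceVol hA).integrableOn

theorem continuous_volume_real_leftPart (hA : IsCompact A) :
    Continuous fun x => volume.real (leftPart A x) := by
  have h : ∀ x, volume.real (leftPart A x) =
      volume.real (leftPart A 0) + ∫ s in (0 : ℝ)..x, sliceVol A s := fun x => by
    rw [← volume_real_leftPart_sub hA]; ring
  rw [funext h]
  exact continuous_const.add (intervalIntegral.continuous_primitive
    (fun a b => (integrable_sliceVol hA).intervalIntegrable) 0)

theorem hasDerivAt_volume_real_leftPart (hA : IsCompact A) {x : ℝ}
    (hx : ContinuousAt (sliceVol A) x) :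
    HasDerivAt (fun x => volume.real (leftPart A x)) (sliceVol A x) x := by
  have h : ∀ x, volume.real (leftPart A x) =
      volume.real (leftPart A 0) + ∫ s in (0 : ℝ)..x, sliceVol A s := fun x => by
    rw [← volume_real_leftPart_sub hA]; ring
  rw [funext h]
  exact (intervalIntegral.integral_hasDerivAt_right (integrable_sliceVol hA).intervalIntegrable
    (measurable_sliceVol hA).stronglyMeasurable.stronglyMeasurableAtFilter hx).const_add _

theorem volume_real_leftPart_least (hA : IsCompact A) {α : ℝ} (hα : IsLeast (Prod.fst '' A) α) :
    volume.real (leftPart A α) = 0 := by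
  rw [volume_real_leftPart hA, integral_Iic_eq_integral_Iio]
  refine setIntegral_eq_zero_of_forall_eq_zero fun s hs => ?_
  by_contra h
  exact (hα.2 (fst_mem_of_sliceVol_pos ((sliceVol_nonneg A s).lt_of_ne' h))).not_gt hs

theorem leftPart_greatest {β : ℝ} (hβ : IsGreatest (Prod.fst '' A) β) : leftPart A β = A :=
  Set.inter_eq_left.2 fun p hp => hβ.2 ⟨p, hp, rfl⟩

end ConvexSlices

/-! ### The equality case: comparison of the marginals -/

/-- The inverse of a distribution function `F` with positive density `f` on `(α, β)`. -/
theorem exists_quantile {f F : ℝ → ℝ} {α β V : ℝ} (hαβ : α < β)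
    (hF : ∀ x ∈ Set.Ioo α β, HasDerivAt F (f x) x) (hf : ∀ x ∈ Set.Ioo α β, 0 < f x)
    (hc : Continuous F) (h0 : F α = 0) (h1 : F β = V) :
    0 < V ∧ (∀ x ∈ Set.Ioo α β, F x ∈ Set.Ioo 0 V) ∧
      ∃ a : ℝ → ℝ, (∀ s ∈ Set.Ioo 0 V, a s ∈ Set.Ioo α β ∧ F (a s) = s ∧
        HasDerivAt a (f (a s))⁻¹ s) ∧ ∀ x ∈ Set.Ioo α β, a (F x) = x := by
  have hmono : StrictMonoOn F (Set.Icc α β) :=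
    strictMonoOn_of_deriv_pos (convex_Icc α β) hc.continuousOn fun x hx => by
      rw [interior_Icc] at hx
      rw [(hF x hx).deriv]; exact hf x hx
  have hmem : ∀ x ∈ Set.Ioo α β, F x ∈ Set.Ioo 0 V := fun x hx => by
    have hx' := Set.Ioo_subset_Icc_self hx
    refine ⟨?_, ?_⟩
    · rw [← h0]; exact hmono (Set.left_mem_Icc.2 hαβ.le) hx' hx.1
    · rw [← h1]; exact hmono hx' (Set.right_mem_Icc.2 hαβ.le) hx.2
  have hex : ∀ s : ℝ, ∃ x, s ∈ Set.Ioo 0 V → x ∈ Set.Ioo α β ∧ F x = s := fun s => by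
    by_cases hs : s ∈ Set.Ioo 0 V
    · rw [← h0, ← h1] at hs
      obtain ⟨x, hx, rfl⟩ := intermediate_value_Ioo hαβ.le hc.continuousOn hs
      exact ⟨x, fun _ => ⟨hx, rfl⟩⟩
    · exact ⟨0, fun h => absurd h hs⟩
  choose a ha using hex
  have hinv : ∀ x ∈ Set.Ioo α β, a (F x) = x := fun x hx =>
    hmono.injOn (Set.Ioo_subset_Icc_self (ha _ (hmem x hx)).1) (Set.Ioo_subset_Icc_self hx)
      (ha _ (hmem x hx)).2
  have hamono : StrictMonoOn a (Set.Ioo 0 V) := fun s hs t ht hst => by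
    rw [← hmono.lt_iff_lt (Set.Ioo_subset_Icc_self (ha s hs).1)
      (Set.Ioo_subset_Icc_self (ha t ht).1),
      (ha s hs).2, (ha t ht).2]
    exact hst
  refine ⟨?_, hmem, a, fun s hs => ⟨(ha s hs).1, (ha s hs).2, ?_⟩, hinv⟩
  · rw [← h0, ← h1]
    exact hmono (Set.left_mem_Icc.2 hαβ.le) (Set.right_mem_Icc.2 hαβ.le) hαβ
  refine HasDerivAt.of_local_left_inverse ?_ (hF _ (ha s hs).1) (hf _ (ha s hs).1).ne' ?_
  · refine hamono.continuousAt_of_image_mem_nhds (isOpen_Ioo.mem_nhds hs) ?_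
    filter_upwards [isOpen_Ioo.mem_nhds (ha s hs).1] with x hx
    exact ⟨F x, hmem x hx, hinv x hx⟩
  · filter_upwards [isOpen_Ioo.mem_nhds hs] with t ht using (ha t ht).2

/-- Two distribution functions whose densities agree at corresponding quantiles are translates of
each other, because the quantile functions have the same derivative. -/
theorem exists_translation_of_density_eq {f F g G : ℝ → ℝ} {α β γ δ V : ℝ} (hαβ : α < β)
    (hγδ : γ < δ) (hF : ∀ x ∈ Set.Ioo α β, HasDerivAt F (f x) x)
    (hG : ∀ x ∈ Set.Ioo γ δ, HasDerivAt G (g x) x) (hf : ∀ x ∈ Set.Ioo α β, 0 < f x)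
    (hg : ∀ x ∈ Set.Ioo γ δ, 0 < g x) (hFc : Continuous F) (hGc : Continuous G) (hF0 : F α = 0)
    (hF1 : F β = V) (hG0 : G γ = 0) (hG1 : G δ = V)
    (hfg : ∀ x ∈ Set.Ioo α β, ∀ y ∈ Set.Ioo γ δ, F x = G y → f x = g y) :
    ∃ c, α = γ + c ∧ β = δ + c ∧ ∀ x ∈ Set.Ioo α β, f x = g (x - c) := by
  obtain ⟨hV, hFm, a, ha, haF⟩ := exists_quantile hαβ hF hf hFc hF0 hF1
  obtain ⟨-, hGm, b, hb, hbG⟩ := exists_quantile hγδ hG hg hGc hG0 hG1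
  have hder : ∀ s ∈ Set.Ioo 0 V, HasDerivAt (fun s => a s - b s) 0 s := fun s hs => by
    have h := hfg _ (ha s hs).1 _ (hb s hs).1 ((ha s hs).2.1.trans (hb s hs).2.1.symm)
    have := (ha s hs).2.2.sub (hb s hs).2.2
    rw [h, sub_self] at this
    exact this
  have hmid : V / 2 ∈ Set.Ioo 0 V := ⟨by linarith, by linarith⟩
  have hconst : ∀ s ∈ Set.Ioo 0 V, a s - b s = a (V / 2) - b (V / 2) := fun s hs =>
    isOpen_Ioo.is_const_of_deriv_eq_zero (f := fun s => a s - b s) isPreconnected_Ioo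
      (fun t ht => (hder t ht).differentiableAt.differentiableWithinAt)
      (fun t ht => (hder t ht).deriv) hs hmid
  set c := a (V / 2) - b (V / 2)
  have h1 : ∀ x ∈ Set.Ioo α β, x - c ∈ Set.Ioo γ δ ∧ G (x - c) = F x := fun x hx => by
    have h := hconst _ (hFm x hx)
    rw [haF x hx] at h
    have : x - c = b (F x) := by linarith
    rw [this]
    exact ⟨(hb _ (hFm x hx)).1, (hb _ (hFm x hx)).2.1⟩
  have h2 : ∀ y ∈ Set.Ioo γ δ, y + c ∈ Set.Ioo α β := fun y hy => by
    have h := hconst _ (hGm y hy)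
    rw [hbG y hy] at h
    have : y + c = a (G y) := by linarith
    rw [this]
    exact (ha _ (hGm y hy)).1
  have s1 : Set.Ioo α β ⊆ Set.Ioo (γ + c) (δ + c) := fun x hx =>
    ⟨by linarith [(h1 x hx).1.1], by linarith [(h1 x hx).1.2]⟩
  have s2 : Set.Ioo (γ + c) (δ + c) ⊆ Set.Ioo α β := fun x hx => by
    simpa using h2 (x - c) ⟨by linarith [hx.1], by linarith [hx.2]⟩
  have i1 := (Set.Ioo_subset_Ioo_iff hαβ).1 s1
  have i2 := (Set.Ioo_subset_Ioo_iff (by linarith)).1 s2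
  exact ⟨c, by linarith, by linarith, fun x hx => hfg x hx _ (h1 x hx).1 (h1 x hx).2.symm⟩

theorem BrunnMinkowski.two_pow_mul_le {n : ℕ} {E : Type*} [AddCommGroup E] [TopologicalSpace E]
    [MeasureSpace E] (h : BrunnMinkowski (n + 1) E) {A B : Set E} (hA : IsCompact A)
    (hB : IsCompact B) (hAB : volume.real A = volume.real B) (hpos : 0 < volume.real A) :
    2 ^ (n + 1) * volume.real A ≤ volume.real (A + B) := by
  have hA' : A.Nonempty := by
    rw [Set.nonempty_iff_ne_empty]; rintro rfl; simp at hpos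
  have hB' : B.Nonempty := by
    rw [Set.nonempty_iff_ne_empty]; rintro rfl; simp at hAB; linarith
  set a := volume.real A ^ (((n + 1 : ℕ) : ℝ)⁻¹) with ha
  have ha0 : 0 ≤ a := Real.rpow_nonneg hpos.le _
  have hpow : a ^ (n + 1) = volume.real A := Real.rpow_inv_natCast_pow hpos.le (by simp)
  have := h hA hB hA' hB' ha0 ha0 hpow.le (hpow.le.trans hAB.le)
  rwa [← two_mul, mul_pow, hpow] at this

/-- The equality case of `(p + q) ^ m * (1 / p ^ m + 1 / q ^ m) ≥ 2 ^ (m + 1)`; for `m = 0` the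
conclusion is trivial. -/
theorem eq_of_add_pow_mul_le {p q : ℝ} (hp : 0 < p) (hq : 0 < q) (m : ℕ)
    (h : (p + q) ^ m * (1 / p ^ m + 1 / q ^ m) ≤ 2 ^ (m + 1)) : p ^ m = q ^ m := by
  -- by AM-GM, both factors on the left are at least the values they have at `p = q`
  obtain ⟨x, hx, rfl⟩ : ∃ x, 0 < x ∧ x ^ 2 = p := ⟨√p, by positivity, Real.sq_sqrt hp.le⟩
  obtain ⟨y, hy, rfl⟩ : ∃ x, 0 < x ∧ x ^ 2 = q := ⟨√q, by positivity, Real.sq_sqrt hq.le⟩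
  have h1 : (2 * (x * y)) ^ m ≤ (x ^ 2 + y ^ 2) ^ m := by
    gcongr; nlinarith [sq_nonneg (x - y)]
  have e : (1 / (x ^ 2) ^ m + 1 / (y ^ 2) ^ m) =
      ((x ^ m) ^ 2 + (y ^ m) ^ 2) / ((x ^ m) ^ 2 * (y ^ m) ^ 2) := by
    field_simp; ring
  have h2 := (mul_le_mul_of_nonneg_right h1 (by positivity)).trans h
  rw [e, mul_pow, mul_pow, pow_succ, mul_assoc] at h2
  have h3 := le_of_mul_le_mul_left h2 (by positivity)
  rw [mul_div_assoc', div_le_iff₀ (by positivity)] at h3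
  have hX : 0 < x ^ m := by positivity
  have hY : 0 < y ^ m := by positivity
  rw [pow_right_comm x, pow_right_comm y]
  generalize x ^ m = X at *
  generalize y ^ m = Y at *
  have h4 : X ^ 2 + Y ^ 2 ≤ 2 * (X * Y) := by
    refine le_of_mul_le_mul_left (h3.trans_eq ?_) (mul_pos hX hY)
    ring
  have : X = Y := by nlinarith [sq_nonneg (X - Y)]
  rw [this]

section Equality

variable {m : ℕ} {A B : Set (ℝ × (Fin m → ℝ))}

/-- In the equality case of the Brunn–Minkowski inequality for sets of equal volume, the largest
slices have the same volume. -/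
theorem maxSlice_eq_of_volume_add_le (hA : IsCompact A) (hB : IsCompact B)
    (hAB : volume.real A = volume.real B) (hpos : 0 < volume.real A)
    (h : volume.real (A + B) ≤ 2 ^ (m + 1) * volume.real A) : maxSlice A = maxSlice B := by
  obtain ⟨p, hp, hpA⟩ := exists_pow_eq_maxSlice hA hpos
  obtain ⟨q, hq, hqB⟩ := exists_pow_eq_maxSlice hB (hAB ▸ hpos)
  have := ((brunnMinkowski_pi m).add_div_maxSlice_le hA hB hp hq hpA hqB).trans h
  rw [← hAB] at this
  rw [← hpA, ← hqB]
  refine eq_of_add_pow_mul_le hp hq m (le_of_mul_le_mul_right (le_trans (le_of_eq ?_) this) hpos)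
  ring

/-- If hyperplanes cut off the same volume to the left from two bodies in the equality case, then
both pairs of corresponding pieces are in the equality case as well; so the two hyperplanes meet
the bodies in slices of the same volume. -/
theorem sliceVol_eq_of_leftPart_eq (hA : IsCompact A) (hB : IsCompact B) (hAc : Convex ℝ A)
    (hBc : Convex ℝ B) (hAB : volume.real A = volume.real B)
    (h : volume.real (A + B) ≤ 2 ^ (m + 1) * volume.real A) {x y : ℝ}
    (hxy : volume.real (leftPart A x) = volume.real (leftPart B y))
    (h0 : 0 < volume.real (leftPart A x)) (h1 : volume.real (leftPart A x) < volume.real A) :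
    sliceVol A x = sliceVol B y := by
  have hAs := volume_real_leftPart_add_rightPart hA x
  have hBs := volume_real_leftPart_add_rightPart hB y
  have hAB' := hA.add hB
  have hs := volume_real_leftPart_add_rightPart hAB' (x + y)
  have hr : volume.real (rightPart A x) = volume.real (rightPart B y) := by linarith
  have hr0 : 0 < volume.real (rightPart A x) := by linarith
  have hbm := (brunnMinkowski_pi m).prod
  have hl1 := hbm.two_pow_mul_le (hA.leftPart x) (hB.leftPart y) hxy h0
  have hr1 := hbm.two_pow_mul_le (hA.rightPart x) (hB.rightPart y) hr hr0
  have hl2 : volume.real (leftPart A x + leftPart B y) ≤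
      volume.real (leftPart (A + B) (x + y)) := by
    refine measureReal_mono ?_ (hAB'.leftPart _).measure_lt_top.ne
    rintro _ ⟨a, ha, b, hb, rfl⟩
    exact ⟨Set.add_mem_add ha.1 hb.1, show a.1 + b.1 ≤ x + y from add_le_add ha.2 hb.2⟩
  have hr2 : volume.real (rightPart A x + rightPart B y) ≤
      volume.real (rightPart (A + B) (x + y)) := by
    refine measureReal_mono ?_ (hAB'.rightPart _).measure_lt_top.ne
    rintro _ ⟨a, ha, b, hb, rfl⟩
    exact ⟨Set.add_mem_add ha.1 hb.1, show x + y ≤ a.1 + b.1 from add_le_add ha.2 hb.2⟩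
  rw [← hAs, mul_add] at h
  rw [sliceVol_eq_min hA hAc, sliceVol_eq_min hB hBc,
    maxSlice_eq_of_volume_add_le (hA.leftPart x) (hB.leftPart y) hxy h0 (by linarith),
    maxSlice_eq_of_volume_add_le (hA.rightPart x) (hB.rightPart y) hr hr0 (by linarith)]

theorem exists_isLeast_isGreatest_fst (hA : IsCompact A) (h : 0 < volume.real A) :
    ∃ α β, α < β ∧ IsLeast (Prod.fst '' A) α ∧ IsGreatest (Prod.fst '' A) β := by
  have hne : A.Nonempty := by
    rw [Set.nonempty_iff_ne_empty]; rintro rfl; simp at h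
  obtain ⟨α, hα⟩ := (hA.image continuous_fst).exists_isLeast (hne.image _)
  obtain ⟨β, hβ⟩ := (hA.image continuous_fst).exists_isGreatest (hne.image _)
  refine ⟨α, β, (hα.2 hβ.1).lt_of_ne ?_, hα, hβ⟩
  rintro rfl
  have := volume_real_leftPart_least hA hα
  rw [leftPart_greatest hβ] at this
  exact h.ne' this

theorem sliceVol_eq_zero_of_notMem (s : ℝ) (hs : s ∉ Prod.fst '' A) : sliceVol A s = 0 := by
  by_contra h
  exact hs (fst_mem_of_sliceVol_pos ((sliceVol_nonneg A s).lt_of_ne' h))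

/-- In the equality case, the distance from the centroid to the rightmost supporting hyperplane
is the same for both bodies. -/
theorem isGreatest_fst_sub_setIntegral_eq (hA : IsCompact A) (hB : IsCompact B) (hAc : Convex ℝ A)
    (hBc : Convex ℝ B) (hAB : volume.real A = volume.real B) (hpos : 0 < volume.real A)
    (h : volume.real (A + B) ≤ 2 ^ (m + 1) * volume.real A) {β δ : ℝ}
    (hβ : IsGreatest (Prod.fst '' A) β) (hδ : IsGreatest (Prod.fst '' B) δ) :
    β * volume.real A - ∫ p in A, p.1 = δ * volume.real A - ∫ p in B, p.1 := by
  obtain ⟨α, β', hαβ, hα, hβ'⟩ := exists_isLeast_isGreatest_fst hA hpos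
  obtain rfl := hβ.unique hβ'
  obtain ⟨γ, δ', hγδ, hγ, hδ'⟩ := exists_isLeast_isGreatest_fst hB (hAB ▸ hpos)
  obtain rfl := hδ.unique hδ'
  have hF : ∀ x ∈ Set.Ioo α β, HasDerivAt (fun x => volume.real (leftPart A x)) (sliceVol A x) x :=
    fun x hx => hasDerivAt_volume_real_leftPart hA
      ((continuousOn_sliceVol hA hAc hα hβ).continuousAt (isOpen_Ioo.mem_nhds hx))
  have hG : ∀ x ∈ Set.Ioo γ δ, HasDerivAt (fun x => volume.real (leftPart B x)) (sliceVol B x) x :=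
    fun x hx => hasDerivAt_volume_real_leftPart hB
      ((continuousOn_sliceVol hB hBc hγ hδ).continuousAt (isOpen_Ioo.mem_nhds hx))
  have hf := fun x hx => sliceVol_pos_of_mem_Ioo (s := x) hA hAc hpos hα hβ hx
  have hg := fun x hx => sliceVol_pos_of_mem_Ioo (s := x) hB hBc (hAB ▸ hpos) hγ hδ hx
  have hF0 := volume_real_leftPart_least hA hα
  have hG0 := volume_real_leftPart_least hB hγ
  have hF1 : volume.real (leftPart A β) = volume.real A := by rw [leftPart_greatest hβ]
  have hG1 : volume.real (leftPart B δ) = volume.real A := by rw [leftPart_greatest hδ, hAB]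
  have hq := (exists_quantile hαβ hF hf (continuous_volume_real_leftPart hA) hF0 hF1).2.1
  obtain ⟨c, hc1, hc2, hc⟩ := exists_translation_of_density_eq hαβ hγδ hF hG hf hg
    (continuous_volume_real_leftPart hA) (continuous_volume_real_leftPart hB) hF0 hF1 hG0 hG1
    (fun x hx y hy hxy =>
      sliceVol_eq_of_leftPart_eq hA hB hAc hBc hAB h hxy (hq x hx).1 (hq x hx).2)
  -- the marginals agree up to the translation, except perhaps at the endpoints of the projections
  have hae : (fun s => s * sliceVol A s) =ᵐ[volume]
      fun s => (fun t => t * sliceVol B t + c * sliceVol B t) (s - c) := by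
    filter_upwards [(Set.finite_singleton β).insert α |>.measure_zero volume |> compl_mem_ae_iff.2]
      with s hs
    have hs' : s ≠ α ∧ s ≠ β := by simpa [not_or] using hs
    rw [← add_mul, sub_add_cancel]
    by_cases hI : s ∈ Set.Ioo α β
    · rw [hc s hI]
    · rw [sliceVol_eq_zero_of_notMem s, sliceVol_eq_zero_of_notMem (s - c)]
      · intro hm
        have i1 := hγ.2 hm
        have i2 := hδ.2 hm
        exact hI ⟨lt_of_le_of_ne (by linarith) hs'.1.symm, lt_of_le_of_ne (by linarith) hs'.2⟩
      · intro hm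
        exact hI ⟨lt_of_le_of_ne (hα.2 hm) hs'.1.symm, lt_of_le_of_ne (hβ.2 hm) hs'.2⟩
  rw [setIntegral_fst hA, setIntegral_fst hB, integral_congr_ae hae,
    integral_sub_right_eq_self (fun t => t * sliceVol B t + c * sliceVol B t) c,
    integral_add (integrable_mul_sliceVol hB) ((integrable_sliceVol hB).const_mul c),
    integral_const_mul, integral_sliceVol hB, ← hAB, hc2]
  ring

end Equality

/-! ### The equality case: translates -/

theorem exists_equiv_fst_eq {m : ℕ} (φ : (Fin (m + 1) → ℝ) →L[ℝ] ℝ) (hφ : φ ≠ 0) :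
    ∃ e : (Fin (m + 1) → ℝ) ≃L[ℝ] ℝ × (Fin m → ℝ), ∀ x, (e x).1 = φ x := by
  obtain ⟨x₀, hx₀⟩ : ∃ x, φ x ≠ 0 := by
    by_contra! h; exact hφ (ContinuousLinearMap.ext h)
  let r : ℝ →L[ℝ] (Fin (m + 1) → ℝ) := ContinuousLinearMap.toSpanSingleton ℝ ((φ x₀)⁻¹ • x₀)
  have hr : Function.RightInverse r φ := fun t => by
    simp [r, ContinuousLinearMap.toSpanSingleton_apply, hx₀]
  have hrank : Module.finrank ℝ (LinearMap.ker (φ : (Fin (m + 1) → ℝ) →ₗ[ℝ] ℝ)) =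
      Module.finrank ℝ (Fin m → ℝ) := by
    have h1 := LinearMap.finrank_range_add_finrank_ker (φ : (Fin (m + 1) → ℝ) →ₗ[ℝ] ℝ)
    rw [LinearMap.range_eq_top.2 hr.surjective] at h1
    simp at h1 ⊢
    omega
  let e₁ := ContinuousLinearEquiv.equivOfRightInverse φ r hr
  let e₂ : LinearMap.ker (φ : (Fin (m + 1) → ℝ) →ₗ[ℝ] ℝ) ≃L[ℝ] (Fin m → ℝ) :=
    ContinuousLinearEquiv.ofFinrankEq hrank
  exact ⟨e₁.trans ((ContinuousLinearEquiv.refl ℝ ℝ).prodCongr e₂), fun x => rfl⟩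

section Translate

variable {m : ℕ} {A B : Set (Fin (m + 1) → ℝ)}

/-- `isGreatest_fst_sub_setIntegral_eq` in an arbitrary direction `φ`. -/
theorem isGreatest_sub_setIntegral_eq (hA : IsCompact A) (hB : IsCompact B) (hAc : Convex ℝ A)
    (hBc : Convex ℝ B) (hAB : volume.real A = volume.real B) (hpos : 0 < volume.real A)
    (h : volume.real (A + B) ≤ 2 ^ (m + 1) * volume.real A) {φ : (Fin (m + 1) → ℝ) →L[ℝ] ℝ}
    (hφ : φ ≠ 0) {β δ : ℝ} (hβ : IsGreatest (φ '' A) β) (hδ : IsGreatest (φ '' B) δ) :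
    β * volume.real A - ∫ x in A, φ x = δ * volume.real A - ∫ x in B, φ x := by
  obtain ⟨e, he⟩ := exists_equiv_fst_eq φ hφ
  have hfst : ∀ S : Set (Fin (m + 1) → ℝ), Prod.fst '' (e '' S) = φ '' S := fun S => by
    rw [Set.image_image]; simp only [he]
  -- the pulled back volume is a multiple of the volume
  let ν : Measure (Fin (m + 1) → ℝ) := Measure.map e.symm volume
  have : ν.IsAddHaarMeasure := e.symm.isAddHaarMeasure_map volume
  have hemb : MeasurableEmbedding e.symm := e.symm.toHomeomorph.measurableEmbedding
  set κ : ℝ≥0 := Measure.addHaarScalarFactor ν volume with hκ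
  have hκ0 : 0 < κ := Measure.addHaarScalarFactor_pos_of_isAddHaarMeasure ν volume
  have hν : ν = κ • volume := Measure.isAddLeftInvariant_eq_smul ν volume
  have hpre : ∀ S : Set (Fin (m + 1) → ℝ), e.symm ⁻¹' S = e '' S := fun S =>
    (e.toEquiv.image_eq_preimage_symm S).symm
  have hvol : ∀ S : Set (Fin (m + 1) → ℝ), volume.real (e '' S) = κ * volume.real S := fun S => by
    have : ν S = volume (e '' S) := by rw [hemb.map_apply, hpre]
    rw [Measure.real, ← this, hν]
    simp [Measure.real]
  have hint : ∀ S : Set (Fin (m + 1) → ℝ), ∫ p in e '' S, p.1 = κ * ∫ x in S, φ x := fun S => by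
    have h1 := hemb.setIntegral_map (μ := volume) φ S
    rw [hpre, show Measure.map e.symm volume = κ • volume from hν, Measure.restrict_smul,
      integral_smul_nnreal_measure] at h1
    have h2 : ∀ p : ℝ × (Fin m → ℝ), φ (e.symm p) = p.1 := fun p => by rw [← he]; simp
    simp only [h2] at h1
    rw [← h1]; rfl
  have hadd : e '' (A + B) = e '' A + e '' B := Set.image_add e
  have hlin : ∀ {S : Set (Fin (m + 1) → ℝ)}, Convex ℝ S → Convex ℝ (e '' S) := fun hS =>
    hS.linear_image (e : (Fin (m + 1) → ℝ) →ₗ[ℝ] ℝ × (Fin m → ℝ))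
  have hκ' : (0 : ℝ) < κ := hκ0
  have key := isGreatest_fst_sub_setIntegral_eq (hA.image e.continuous) (hB.image e.continuous)
    (hlin hAc) (hlin hBc) (by rw [hvol, hvol, hAB]) (by rw [hvol]; positivity)
    (by rw [← hadd, hvol, hvol, mul_left_comm]; gcongr) ((hfst A).symm ▸ hβ) ((hfst B).symm ▸ hδ)
  rw [hint, hint, hvol] at key
  refine mul_left_cancel₀ hκ'.ne' ?_
  linarith

theorem continuousLinearMap_setAverage (hA : IsCompact A) (φ : (Fin (m + 1) → ℝ) →L[ℝ] ℝ) :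
    φ (⨍ x in A, x) = (volume.real A)⁻¹ * ∫ x in A, φ x := by
  rw [setAverage_eq, map_smul, smul_eq_mul, ContinuousLinearMap.integral_comp_comm]
  exact continuousOn_id.integrableOn_compact hA

/-- If a point of `A` were missing from the translate of `B`, a functional `φ` would separate the
two, although both have the same maximum of `φ`. -/
theorem subset_translate_of_volume_add_le (hA : IsCompact A) (hB : IsCompact B) (hAc : Convex ℝ A)
    (hBc : Convex ℝ B) (hAB : volume.real A = volume.real B) (hpos : 0 < volume.real A)
    (h : volume.real (A + B) ≤ 2 ^ (m + 1) * volume.real A) :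
    A ⊆ (fun y => ((⨍ x in A, x) - ⨍ x in B, x) + y) '' B := by
  intro x hx
  by_contra hxB
  set g := (⨍ x in A, x) - ⨍ x in B, x with hg
  have hB' : B.Nonempty := by
    rw [Set.nonempty_iff_ne_empty]; rintro rfl; simp at hAB; linarith
  obtain ⟨φ, u, hφB, hφx⟩ := geometric_hahn_banach_closed_point
    (hBc.translate g) (hB.image (by fun_prop)).isClosed hxB
  obtain ⟨b, hb⟩ := hB'
  have hφ : φ ≠ 0 := by
    rintro rfl
    have := hφB _ ⟨b, hb, rfl⟩
    exact lt_asymm this hφx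
  obtain ⟨β, hβ⟩ := (hA.image φ.continuous).exists_isGreatest ⟨_, x, hx, rfl⟩
  obtain ⟨δ, hδ⟩ := (hB.image φ.continuous).exists_isGreatest ⟨_, b, hb, rfl⟩
  have key := isGreatest_sub_setIntegral_eq hA hB hAc hBc hAB hpos h hφ hβ hδ
  have hφg : φ g = β - δ := by
    rw [hg, map_sub, continuousLinearMap_setAverage hA, continuousLinearMap_setAverage hB, ← hAB]
    field_simp
    linarith
  obtain ⟨b', hb', hb'δ⟩ := hδ.1
  have h1 := hφB _ ⟨b', hb', rfl⟩
  have h2 := hβ.2 ⟨x, hx, rfl⟩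
  simp only [map_add, hφg, hb'δ] at h1
  linarith

/-- Equality in the Brunn–Minkowski inequality for convex bodies of the same volume holds only for
translates. -/
theorem exists_eq_translate_of_volume_add_le (hA : IsCompact A) (hB : IsCompact B)
    (hAc : Convex ℝ A) (hBc : Convex ℝ B) (hAB : volume.real A = volume.real B)
    (hpos : 0 < volume.real A) (h : volume.real (A + B) ≤ 2 ^ (m + 1) * volume.real A) :
    ∃ g, A = (fun y => g + y) '' B := by
  refine ⟨_, (subset_translate_of_volume_add_le hA hB hAc hBc hAB hpos h).antisymm ?_⟩
  rintro _ ⟨y, hy, rfl⟩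
  obtain ⟨x, hx, rfl⟩ := subset_translate_of_volume_add_le hB hA hBc hAc hAB.symm (hAB ▸ hpos)
    (by rwa [add_comm B A, ← hAB]) hy
  simpa only [← add_assoc, sub_add_sub_cancel, sub_self, zero_add] using hx

end Translate

/-! ### The boundary as a derivative -/

theorem tendsto_ofReal_slope {ψ : ℝ → ℝ} {d : ℝ} (h : HasDerivWithinAt ψ d (Set.Ioi 0) 0) :
    Tendsto (fun ε : ℝ => ENNReal.ofReal ((ψ ε - ψ 0) / ε)) (𝓝[>] 0) (𝓝 (ENNReal.ofReal d)) := by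
  rw [hasDerivWithinAt_iff_tendsto_slope' (by simp)] at h
  refine (ENNReal.tendsto_ofReal h).congr fun ε => ?_
  rw [slope_def_field, sub_zero]

theorem ofReal_sub_div {x y ε : ℝ} (hy : 0 ≤ y) (hε : 0 < ε) :
    (ENNReal.ofReal x - ENNReal.ofReal y) / ENNReal.ofReal ε = ENNReal.ofReal ((x - y) / ε) := by
  rw [ENNReal.ofReal_div_of_pos hε, ENNReal.ofReal_sub x hy]

theorem hasBoundary_of_hasDerivWithinAt {n : ℕ} {Z A : Set (Fin n → ℝ)} {ψ : ℝ → ℝ} {d : ℝ}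
    (hψ : ∀ ε, 0 < ε → volume (A + ε • Z) = ENNReal.ofReal (ψ ε))
    (hψ0 : volume A = ENNReal.ofReal (ψ 0)) (h0 : 0 ≤ ψ 0)
    (h : HasDerivWithinAt ψ d (Set.Ioi 0) 0) : HasBoundary Z A (ENNReal.ofReal d) := by
  refine (tendsto_ofReal_slope h).congr' ?_
  filter_upwards [self_mem_nhdsWithin] with ε hε
  rw [hψ ε hε, hψ0, ofReal_sub_div h0 hε]

theorem hasDerivWithinAt_add_mul_pow (a z : ℝ) (m : ℕ) :
    HasDerivWithinAt (fun ε : ℝ => (a + ε * z) ^ (m + 1)) ((m + 1) * a ^ m * z) (Set.Ioi 0) 0 := by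
  have := ((((hasDerivAt_id (0 : ℝ)).mul_const z).const_add a).fun_pow (m + 1)).hasDerivWithinAt
    (s := Set.Ioi 0)
  simpa using this

section Body

variable {m : ℕ} {Z A : Set (Fin (m + 1) → ℝ)}

/-- The Brunn–Minkowski inequality for the outer measure of an arbitrary set `A` and a convex body
`Z`. -/
theorem ofReal_add_mul_pow_le (hZ : IsCompact Z) (hZc : Convex ℝ Z) (hZi : (interior Z).Nonempty)
    {a z ε : ℝ} (ha : 0 < a) (hz : 0 ≤ z) (hzZ : z ^ (m + 1) = volume.real Z)
    (hA : volume A = ENNReal.ofReal (a ^ (m + 1))) (hε : 0 < ε) :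
    ENNReal.ofReal ((a + ε * z) ^ (m + 1)) ≤ volume (A + ε • Z) := by
  -- A small part of `ε • Z` turns `A` into an open set, the rest is used for the inequality.
  have key : ∀ t ∈ Set.Ioo (0 : ℝ) 1,
      ENNReal.ofReal ((t * (a + ε * z)) ^ (m + 1)) ≤ volume (A + ε • Z) := by
    rintro t ⟨ht0, ht1⟩
    obtain ⟨w, hw⟩ := hZi
    have hδ : (1 - t) * ε ≠ 0 := by
      have : 0 < 1 - t := by linarith
      positivity
    have hU : IsOpen (A + ((1 - t) * ε) • interior Z) := (isOpen_interior.smul₀ hδ).add_left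
    have hlt : ENNReal.ofReal ((t * a) ^ (m + 1)) < volume (A + ((1 - t) * ε) • interior Z) := by
      refine lt_of_lt_of_le (b := volume A) ?_ ?_
      · rw [hA, ENNReal.ofReal_lt_ofReal_iff (by positivity)]
        exact pow_lt_pow_left₀ (by nlinarith) (by positivity) (by simp)
      · calc volume A = volume ((fun x => x + ((1 - t) * ε) • w) '' A) := by simp
          _ ≤ _ := by
            refine measure_mono ?_
            rintro _ ⟨x, hx, rfl⟩
            exact Set.add_mem_add hx (Set.smul_mem_smul_set hw)
    obtain ⟨K, hKU, hK, hKlt⟩ := hU.exists_lt_isCompact hlt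
    have hK' : K.Nonempty := by
      rw [Set.nonempty_iff_ne_empty]; rintro rfl; simp at hKlt
    have hZ' : Z.Nonempty := ⟨w, interior_subset hw⟩
    have hZt := hZ.smul (t * ε)
    have hbm := brunnMinkowski_pi (m + 1) hK hZt hK' hZ'.smul_set
      (show 0 ≤ t * a by positivity) (show 0 ≤ t * ε * z by positivity)
      ((ENNReal.ofReal_le_iff_le_toReal hK.measure_lt_top.ne).1 hKlt.le)
      (by rw [volume_real_smul_pi (by positivity), mul_pow, hzZ])
    have hsub : K + (t * ε) • Z ⊆ A + ε • Z := by
      have e : ε • Z = ((1 - t) * ε) • Z + (t * ε) • Z := by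
        rw [← hZc.add_smul (by nlinarith) (by positivity)]
        congr 1; ring
      rw [e, ← add_assoc]
      exact Set.add_subset_add_right (hKU.trans
        (Set.add_subset_add_left (Set.smul_set_mono interior_subset)))
    rw [show t * (a + ε * z) = t * a + t * ε * z by ring]
    exact (ENNReal.ofReal_le_of_le_toReal hbm).trans (measure_mono hsub)
  have hlim : Tendsto (fun t : ℝ => ENNReal.ofReal ((t * (a + ε * z)) ^ (m + 1))) (𝓝[<] 1)
      (𝓝 (ENNReal.ofReal ((1 * (a + ε * z)) ^ (m + 1)))) := by
    refine Tendsto.mono_left (Continuous.tendsto ?_ 1) nhdsWithin_le_nhds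
    exact ENNReal.continuous_ofReal.comp (by fun_prop)
  rw [one_mul] at hlim
  refine le_of_tendsto hlim ?_
  filter_upwards [Ioo_mem_nhdsLT (show (0 : ℝ) < 1 by norm_num)] with t ht using key t ht

/-- The right side of the Brunn–Minkowski inequality, `(a + ε z) ^ n`, has derivative
`n a ^ (n - 1) z` at `ε = 0`. -/
theorem le_of_hasBoundary (hZ : IsCompact Z) (hZc : Convex ℝ Z) (hZi : (interior Z).Nonempty)
    {a z : ℝ} (ha : 0 < a) (hz : 0 ≤ z) (hzZ : z ^ (m + 1) = volume.real Z)
    (hA : volume A = ENNReal.ofReal (a ^ (m + 1))) {β : ℝ≥0∞} (hβ : HasBoundary Z A β) :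
    ENNReal.ofReal ((m + 1) * a ^ m * z) ≤ β := by
  refine le_of_tendsto_of_tendsto (tendsto_ofReal_slope (hasDerivWithinAt_add_mul_pow a z m)) hβ ?_
  filter_upwards [self_mem_nhdsWithin] with ε hε
  rw [hA, zero_mul, add_zero, ← ofReal_sub_div (by positivity) hε]
  gcongr
  exact ofReal_add_mul_pow_le hZ hZc hZi ha hz hzZ hA hε

theorem hasBoundary_smul_self (hZ : IsCompact Z) (hZc : Convex ℝ Z) {c z : ℝ} (hc : 0 ≤ c)
    (hz : 0 ≤ z) (hzZ : z ^ (m + 1) = volume.real Z) :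
    HasBoundary Z (c • Z) (ENNReal.ofReal ((m + 1) * (c * z) ^ m * z)) := by
  have hv : ∀ t : ℝ, 0 ≤ t → volume (t • Z) = ENNReal.ofReal ((t * z) ^ (m + 1)) := fun t ht => by
    rw [mul_pow, hzZ, ← volume_real_smul_pi ht, ofReal_measureReal (hZ.smul t).measure_lt_top.ne]
  refine hasBoundary_of_hasDerivWithinAt (ψ := fun ε => (c * z + ε * z) ^ (m + 1)) (fun ε hε => ?_)
    (by simpa using hv c hc) (by positivity) (hasDerivWithinAt_add_mul_pow (c * z) z m)
  rw [← hZc.add_smul hc hε.le, hv _ (by positivity), add_mul]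

/-- A bounded set fits into a translate of a multiple of a convex body. -/
theorem exists_subset_image_smul (hZ : IsCompact Z) (hAi : (interior A).Nonempty) :
    ∃ R : ℝ, 0 < R ∧ ∃ w, Z ⊆ (fun x => w + R • x) '' A := by
  obtain ⟨x₀, hx₀⟩ := hAi
  obtain ⟨ρ, hρ, hball⟩ := Metric.isOpen_iff.1 isOpen_interior x₀ hx₀
  obtain ⟨r, hr0, hr⟩ := hZ.isBounded.subset_ball_lt 0 (0 : Fin (m + 1) → ℝ)
  refine ⟨r / ρ, by positivity, -((r / ρ) • x₀), fun y hy => ⟨x₀ + (ρ / r) • y, ?_, ?_⟩⟩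
  · refine interior_subset (hball ?_)
    have : ‖y‖ < r := by simpa using hr hy
    rw [mem_ball_iff_norm, add_sub_cancel_left, norm_smul, Real.norm_of_nonneg (by positivity),
      div_mul_eq_mul_div, div_lt_iff₀ hr0]
    gcongr
  · simp only [smul_add, smul_smul]
    rw [neg_add_cancel_left, show r / ρ * (ρ / r) = 1 by field_simp, one_smul]

theorem interior_nonempty_of_volume_pos (hAc : Convex ℝ A) (h : 0 < volume.real A) :
    (interior A).Nonempty := by
  rw [hAc.interior_nonempty_iff_affineSpan_eq_top]
  by_contra hspan
  have h0 := measure_mono_null (subset_affineSpan ℝ A)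
    (Measure.addHaar_affineSubspace volume _ hspan)
  simp [Measure.real, h0] at h

/-- For convex `A`, the `n`-th root of the volume of `A + ε • Z` is concave in `ε`, and so has a
right derivative at `0`, which bounds all the difference quotients. -/
theorem exists_hasBoundary (hZ : IsCompact Z) (hZc : Convex ℝ Z) (hZi : (interior Z).Nonempty)
    {a z : ℝ} (ha : 0 < a) (hz : 0 ≤ z) (hzZ : z ^ (m + 1) = volume.real Z) (hA : IsCompact A)
    (hAc : Convex ℝ A) (haA : a ^ (m + 1) = volume.real A) :
    ∃ L, z ≤ L ∧ HasBoundary Z A (ENNReal.ofReal ((m + 1) * a ^ m * L)) ∧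
      ∀ ε, 0 < ε → volume.real (A + ε • Z) ≤ (a + ε * L) ^ (m + 1) := by
  have hZ' : Z.Nonempty := hZi.mono interior_subset
  have hApos : 0 < volume.real A := haA ▸ by positivity
  have hA' : A.Nonempty := by
    rw [Set.nonempty_iff_ne_empty]; rintro rfl; simp at hApos
  have hAZ : ∀ ε : ℝ, IsCompact (A + ε • Z) := fun ε => hA.add (hZ.smul ε)
  have hvolA : volume A = ENNReal.ofReal (a ^ (m + 1)) := by
    rw [haA, ofReal_measureReal hA.measure_lt_top.ne]
  set φ : ℝ → ℝ := fun ε => volume.real (A + ε • Z) ^ (((m + 1 : ℕ) : ℝ)⁻¹) with hφ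
  have hφn : ∀ ε, 0 ≤ φ ε := fun ε => Real.rpow_nonneg measureReal_nonneg _
  have hφpow : ∀ ε, φ ε ^ (m + 1) = volume.real (A + ε • Z) := fun ε =>
    Real.rpow_inv_natCast_pow measureReal_nonneg (by simp)
  have hroot : ∀ {x y : ℝ}, 0 ≤ y → x ^ (m + 1) ≤ y ^ (m + 1) → x ≤ y := fun hy h =>
    le_of_pow_le_pow_left₀ (by simp) hy h
  have hφ0 : φ 0 = a := by
    refine (pow_left_inj₀ (hφn 0) ha.le (Nat.succ_ne_zero m)).1 ?_
    rw [hφpow, haA, Set.zero_smul_set hZ', add_zero]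
  -- the lower bound given by the Brunn–Minkowski inequality
  have hlow : ∀ ε, 0 < ε → a + ε * z ≤ φ ε := fun ε hε => by
    refine hroot (hφn ε) ?_
    rw [hφpow]
    exact (ENNReal.ofReal_le_iff_le_toReal (hAZ ε).measure_lt_top.ne).1
      (ofReal_add_mul_pow_le hZ hZc hZi ha hz hzZ hvolA hε)
  -- the upper bound, from an inclusion of `Z` in a translate of `R • A`
  obtain ⟨R, hR, w, hw⟩ := exists_subset_image_smul hZ (interior_nonempty_of_volume_pos hAc hApos)
  have hup : ∀ ε, 0 < ε → φ ε ≤ (1 + ε * R) * a := fun ε hε => by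
    refine hroot (by positivity) ?_
    rw [hφpow, mul_pow, haA, ← volume_real_smul_pi (by positivity)]
    have hsub : A + ε • Z ⊆ (fun x => ε • w + x) '' ((1 + ε * R) • A) := by
      rw [hAc.add_smul zero_le_one (by positivity), one_smul]
      rintro _ ⟨x, hx, _, ⟨y, hy, rfl⟩, rfl⟩
      obtain ⟨u, hu, rfl⟩ := hw hy
      refine ⟨x + (ε * R) • u, Set.add_mem_add hx (Set.smul_mem_smul_set hu), ?_⟩
      simp only [smul_add, smul_smul]
      abel
    refine (measureReal_mono hsub ?_).trans (le_of_eq ?_)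
    · exact ((hA.smul _).image (by fun_prop)).measure_lt_top.ne
    · simp [Measure.real]
  have hconc : ∀ s t, 0 < s → s ≤ t → (1 - s / t) * a + s / t * φ t ≤ φ s := fun s t hs hst => by
    have ht : 0 < t := hs.trans_le hst
    have h1 : 0 ≤ s / t := by positivity
    have h2 : 0 ≤ 1 - s / t := by rw [sub_nonneg, div_le_one ht]; exact hst
    refine hroot (hφn s) ?_
    rw [hφpow]
    have hsub : (1 - s / t) • A + (s / t) • (A + t • Z) = A + s • Z := by
      rw [smul_add, ← add_assoc, ← hAc.add_smul h2 h1, smul_smul, sub_add_cancel, one_smul,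
        div_mul_cancel₀ _ ht.ne']
    rw [← hsub]
    exact brunnMinkowski_pi (m + 1) (hA.smul _) ((hAZ t).smul _) hA'.smul_set
      (hA'.add hZ'.smul_set).smul_set (by positivity) (mul_nonneg h1 (hφn t))
      (by rw [volume_real_smul_pi h2, mul_pow, haA])
      (by rw [volume_real_smul_pi h1, mul_pow, hφpow])
  have hanti : AntitoneOn (slope φ 0) (Set.Ioi 0) := fun s hs t ht hst => by
    have hs' : (0 : ℝ) < s := hs
    have ht' : (0 : ℝ) < t := ht
    have := hconc s t hs hst
    rw [slope_def_field, slope_def_field, hφ0, sub_zero, sub_zero, div_le_div_iff₀ ht' hs']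
    have e : (1 - s / t) * a + s / t * φ t = (a * t + s * (φ t - a)) / t := by
      field_simp; ring
    rw [e, div_le_iff₀ ht'] at this
    linarith
  have hbdd : BddAbove (slope φ 0 '' Set.Ioi 0) := by
    refine ⟨R * a, ?_⟩
    rintro _ ⟨ε, hε, rfl⟩
    rw [slope_def_field, hφ0, sub_zero, div_le_iff₀ hε]
    linarith [hup ε hε]
  have hlim := hanti.tendsto_nhdsGT hbdd
  set L := sSup (slope φ 0 '' Set.Ioi 0)
  have hslope : ∀ ε, 0 < ε → φ ε ≤ a + ε * L := fun ε hε => by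
    have := le_csSup hbdd ⟨ε, hε, rfl⟩
    rw [slope_def_field, hφ0, sub_zero, div_le_iff₀ hε] at this
    linarith
  have hder : HasDerivWithinAt φ L (Set.Ioi 0) 0 :=
    (hasDerivWithinAt_iff_tendsto_slope' (by simp)).2 hlim
  refine ⟨L, ?_, ?_, fun ε hε => ?_⟩
  · have := (hlow 1 one_pos).trans (hslope 1 one_pos)
    linarith
  · refine hasBoundary_of_hasDerivWithinAt (ψ := fun ε => φ ε ^ (m + 1)) (fun ε _ => ?_) ?_
      (by positivity) ?_
    · rw [hφpow, ofReal_measureReal (hAZ ε).measure_lt_top.ne]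
    · simp only [hφ0, hvolA]
    · have := hder.fun_pow (m + 1)
      simpa [hφ0] using this
  · rw [← hφpow]
    exact pow_le_pow_left₀ (hφn ε) (hslope ε hε) _

theorem HasBoundary.translate {n : ℕ} {Z A : Set (Fin n → ℝ)} {β : ℝ≥0∞} (h : HasBoundary Z A β)
    (g : Fin n → ℝ) : HasBoundary Z ((fun y => g + y) '' A) β := by
  have h1 : ∀ S : Set (Fin n → ℝ), volume ((fun y => g + y) '' S) = volume S := fun S => by simp
  refine h.congr fun ε => ?_
  have h2 : (fun y => g + y) '' A + ε • Z = (fun y => g + y) '' (A + ε • Z) := by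
    rw [← Set.singleton_add, ← Set.singleton_add, add_assoc]
  rw [h2, h1, h1]

theorem HasBoundary.unique {n : ℕ} {Z A : Set (Fin n → ℝ)} {β γ : ℝ≥0∞} (h : HasBoundary Z A β)
    (h' : HasBoundary Z A γ) : β = γ :=
  tendsto_nhds_unique h h'

theorem Homothetic.exists_eq_translate {X : Set (Fin (m + 1) → ℝ)} (h : Homothetic A X)
    (hv : volume.real A = volume.real X) (hpos : 0 < volume.real X) :
    ∃ g, A = (fun y => g + y) '' X := by
  obtain ⟨r, hr, x, rfl⟩ := h
  have e : (fun y => x + r • y) '' X = (fun y => x + y) '' (r • X) := by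
    rw [← Set.image_smul, Set.image_image]
  have h1 : volume.real ((fun y => x + r • y) '' X) = r ^ (m + 1) * volume.real X := by
    rw [e, ← volume_real_smul_pi hr.le]; simp [Measure.real]
  rw [h1] at hv
  have h2 : r ^ (m + 1) = 1 := by
    refine mul_right_cancel₀ hpos.ne' ?_
    rw [hv, one_mul]
  obtain rfl : r = 1 := (pow_eq_one_iff_of_nonneg hr.le (by simp)).1 h2
  exact ⟨x, by simp⟩

/-- The isoperimetric inequality for an arbitrary convex body `Z` in positive dimension. -/
theorem isoperimetric (hZ : IsCompact Z) (hZc : Convex ℝ Z) (hZi : (interior Z).Nonempty)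
    {c : ℝ} (hc : 0 < c) :
    ∃ bX : ℝ≥0, HasBoundary Z (c • Z) bX ∧
      (∀ A : Set (Fin (m + 1) → ℝ), volume A = volume (c • Z) →
        ∀ bA : ℝ≥0∞, HasBoundary Z A bA → (bX : ℝ≥0∞) ≤ bA) ∧
      (∀ A : ConvexBody (Fin (m + 1) → ℝ), volume (A : Set (Fin (m + 1) → ℝ)) = volume (c • Z) →
        ∃ bA : ℝ≥0, HasBoundary Z A bA ∧ bX ≤ bA ∧
          (bX = bA ↔ Homothetic (A : Set (Fin (m + 1) → ℝ)) (c • Z))) := by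
  have hZpos : 0 < volume.real Z :=
    ENNReal.toReal_pos (Measure.measure_pos_of_nonempty_interior volume hZi).ne'
      hZ.measure_lt_top.ne
  obtain ⟨z, hz, hzZ⟩ : ∃ z : ℝ, 0 < z ∧ z ^ (m + 1) = volume.real Z :=
    ⟨volume.real Z ^ (((m + 1 : ℕ) : ℝ)⁻¹), Real.rpow_pos_of_pos hZpos _,
      Real.rpow_inv_natCast_pow hZpos.le (by simp)⟩
  have ha : 0 < c * z := by positivity
  have hX : IsCompact (c • Z) := hZ.smul c
  have hXr : volume.real (c • Z) = (c * z) ^ (m + 1) := by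
    rw [volume_real_smul_pi hc.le, mul_pow, hzZ]
  have hXv : volume (c • Z) = ENNReal.ofReal ((c * z) ^ (m + 1)) := by
    rw [← hXr, ofReal_measureReal hX.measure_lt_top.ne]
  have hbX := hasBoundary_smul_self hZ hZc hc.le hz.le hzZ
  refine ⟨((m + 1) * (c * z) ^ m * z).toNNReal, hbX, fun A hA bA hbA =>
    le_of_hasBoundary hZ hZc hZi ha hz.le hzZ (hA.trans hXv) hbA, fun A hA => ?_⟩
  have hAr : volume.real (A : Set (Fin (m + 1) → ℝ)) = volume.real (c • Z) := by
    rw [Measure.real, hA, Measure.real]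
  obtain ⟨L, hzL, hbA, hL⟩ := exists_hasBoundary hZ hZc hZi ha hz.le hzZ A.isCompact A.convex
    (hXr.symm.trans hAr.symm)
  have hcoef : (0 : ℝ) < (m + 1) * (c * z) ^ m := by positivity
  refine ⟨((m + 1) * (c * z) ^ m * L).toNNReal, hbA, ?_, fun h => ?_, fun h => ?_⟩
  · exact Real.toNNReal_le_toNNReal (by gcongr)
  · have hLz : L = z := by
      rw [Real.toNNReal_eq_toNNReal_iff (by positivity)
        (mul_nonneg hcoef.le (hz.le.trans hzL))] at h
      exact (mul_left_cancel₀ hcoef.ne' h).symm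
    have h2 := hL c hc
    rw [hLz, ← two_mul, mul_pow, ← hXr, ← hAr] at h2
    obtain ⟨g, hg⟩ := exists_eq_translate_of_volume_add_le A.isCompact hX A.convex (hZc.smul c) hAr
      (by rw [hAr, hXr]; positivity) h2
    exact ⟨1, one_pos, g, by simpa using hg⟩
  · obtain ⟨g, hg⟩ := h.exists_eq_translate hAr (by rw [hXr]; positivity)
    rw [hg] at hbA
    have := (hbX.translate g).unique hbA
    exact ENNReal.coe_injective this

end Body

/-! ### The zonotope -/

section Zonotope

variable {n k : ℕ} (v : Fin k → Fin n → ℤ)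

theorem isCompact_zonotope : IsCompact (zonotope v) := by
  refine Finset.sum_induction _ IsCompact (fun _ _ => IsCompact.add) isCompact_singleton
    fun i _ => ?_
  have : IsCompact (edgeSegment v i) := by
    rw [edgeSegment, ← convexHull_pair (𝕜 := ℝ)]
    exact (Set.toFinite _).isCompact_convexHull ℝ
  exact this.neg.add this

theorem convex_zonotope : Convex ℝ (zonotope v) :=
  convex_sum _ fun _ _ => (convex_segment _ _).neg.add (convex_segment _ _)

theorem sum_mem_zonotope (f : Fin k → Fin n → ℝ) (hf : ∀ i, f i ∈ edgeSegment v i) :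
    ∑ i, f i ∈ zonotope v := by
  refine Set.finsetSum_mem_finsetSum _ _ _ fun i _ => ?_
  rw [← zero_add (f i)]
  refine Set.add_mem_add ?_ (hf i)
  simpa [edgeSegment] using left_mem_segment ℝ (0 : Fin n → ℝ) (intVec (v i))

theorem zero_mem_zonotope : (0 : Fin n → ℝ) ∈ zonotope v := by
  simpa using sum_mem_zonotope v (fun _ => 0) fun i => left_mem_segment ℝ _ _

theorem intVec_mem_zonotope (i : Fin k) : intVec (v i) ∈ zonotope v := by
  have := sum_mem_zonotope v (fun j => if j = i then intVec (v i) else 0) fun j => by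
    split_ifs with h
    · exact h ▸ right_mem_segment ℝ _ _
    · exact left_mem_segment ℝ _ _
  simpa using this

theorem interior_zonotope_nonempty
    (h : Submodule.span ℝ (Set.range fun i => intVec (v i)) = ⊤) :
    (interior (zonotope v)).Nonempty := by
  rw [(convex_zonotope v).interior_nonempty_iff_affineSpan_eq_top,
    AffineSubspace.affineSpan_eq_top_iff_vectorSpan_eq_top_of_nonempty _ _ _
      ⟨0, zero_mem_zonotope v⟩, vectorSpan_eq_span_vsub_set_right ℝ (zero_mem_zonotope v),
    eq_top_iff, ← h]
  refine Submodule.span_mono ?_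
  rintro _ ⟨i, rfl⟩
  exact ⟨_, intVec_mem_zonotope v i, by simp⟩

end Zonotope

theorem hasBoundary_fin_zero {Z A : Set (Fin 0 → ℝ)} (hZ : Z.Nonempty) (hA : A.Nonempty) :
    HasBoundary Z A 0 := by
  have h : ∀ ε : ℝ, A + ε • Z = A := fun ε => by
    rw [Subsingleton.eq_univ_of_nonempty hA,
      Subsingleton.eq_univ_of_nonempty (Set.univ_nonempty.add hZ.smul_set)]
  simp [HasBoundary, h]

theorem theorem2 {n k : ℕ} (G : SimpleGraph (Fin n → ℤ)) (v : Fin k → Fin n → ℤ)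
    (hG : IsPLGraph G v) (X : Set (Fin n → ℝ)) (hX : ∃ c : ℝ, 0 < c ∧ X = c • zonotope v) :
    ∃ bX : ℝ≥0, HasBoundary (zonotope v) X bX ∧
      (∀ A : Set (Fin n → ℝ), volume A = volume X →
        ∀ bA : ℝ≥0∞, HasBoundary (zonotope v) A bA → (bX : ℝ≥0∞) ≤ bA) ∧
      (∀ A : ConvexBody (Fin n → ℝ), volume (A : Set (Fin n → ℝ)) = volume X →
        ∃ bA : ℝ≥0, HasBoundary (zonotope v) A bA ∧ bX ≤ bA ∧
          (bX = bA ↔ Homothetic (A : Set (Fin n → ℝ)) X)) := by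
  obtain ⟨c, hc, rfl⟩ := hX
  cases n with
  | zero =>
    have hZ : (zonotope v).Nonempty := ⟨0, zero_mem_zonotope v⟩
    have hX : (c • zonotope v).Nonempty := hZ.smul_set
    refine ⟨0, hasBoundary_fin_zero hZ hX, fun _ _ _ _ => zero_le, fun A _ => ?_⟩
    refine ⟨0, hasBoundary_fin_zero hZ A.nonempty, le_rfl, fun _ => ⟨1, one_pos, 0, ?_⟩,
      fun _ => rfl⟩
    rw [Subsingleton.eq_univ_of_nonempty A.nonempty,
      Subsingleton.eq_univ_of_nonempty (hX.image _)]
  | succ m =>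
    exact isoperimetric (isCompact_zonotope v) (convex_zonotope v)
      (interior_zonotope_nonempty v hG.span_eq_top) hc
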